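/- Let $\mathcal X$ be a Polish space and let $(\Omega,\mathcal F,\mathcal F_t,X_t,P^x)$, $x\in\mathcal X$, $t\ge 0$, be a time-homogeneous càdlàg Markov family: $X_t$ is an $\mathcal X$-valued, $\mathcal F_t$-adapted process with càdlàg paths; $P^x$ are probability measures on $(\Omega,\mathcal F)$ with $(X_0)_*P^x=\delta_x$ and $x\mapsto P^x(F)$ universally measurable for every $F\in\mathcal F$; and $P^x(X_{t+s}\in B\mid\mathcal F_s)=p_t(X_s,B)$ $P^x$-a.s. for transition probabilities $p_t(x,dy)$. Let $\mu^*$ be an invariant probability measure for $p_t$, and let $A$ with domain $D(A)$ be the generator on $L^2(\mu^*)$ of the semigroup $\mathcal P_tg(x)=\int g(y)\,p_t(x,dy)$. Let $\widetilde P^x$, $x\in\mathcal X$, be any second collection of probability measures on $(\Omega,\mathcal F)$ with $(X_0)_*\widetilde P^x=\delta_x$ and $x\mapsto\widetilde P^x(F)$ universally measurable for every $F\in\mathcal F$ ($X_t$ need not be Markov under $\widetilde P^x$). For probability measures $\mu,\widetilde\mu$ on $\mathcal X$ put $P^{\mu}=\int P^x\mu(dx)$ and $\widetilde P^{\widetilde\mu}=\int\widetilde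 P^x\widetilde\mu(dx)$, and let the subscript $T$ denote restriction to $\mathcal F_T$. Let $R(\cdot\|\cdot)\in[0,\infty]$ be relative entropy, and for $\Lambda:\mathbb R\to[0,\infty]$ and $\eta\in[0,\infty]$ let $\Xi^\pm(\Lambda,\eta)=\inf_{c>0}\frac{\Lambda(\pm c)+\eta}{c}$. Assume that for some $\beta>0$ the log-Sobolev inequality $$\int g^2\log(g^2)\,d\mu^*\le-\beta\int A[g]\,g\,d\mu^*$$ holds for all real-valued $g\in D(A)$ with $\|g\|_{L^2(\mu^*)}=1$. Let $f\in L^1(\mu^*,\mathbb R)$, write $\mu^*[f]=\int f\,d\mu^*$ and $V_c=c\,(f-\mu^*[f])$, and assume that there are $-\infty\le c_-<0<c_+\le\infty$ such that $\int e^{\beta V_{c}}d\mu^*<\infty$ and $\int e^{\beta V_{-c}}d\mu^*<\infty$ for all real $c\in(c_-,c_+)$. Define $$\Lambda(c)=\frac1\beta\log\int e^{\beta V_c}d\mu^*\ \text{ if } c\in(c_-,c_+),\qquad \Lambda(c)=+\infty\ \text{ otherwise}.$$ Then the following hold. 1. For every such collection $\widetilde P^x$, every probability measure $\widetilde\mu$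 on $\mathcal X$ and every $T>0$, with $\eta=\frac1TR(\widetilde P^{\widetilde\mu}_T\|P^{\mu^*}_T)$: if $\eta<\infty$, then $\widetilde P^{\widetilde\mu}$-a.s. $t\mapsto f(X_t)$ is integrable on $[0,T]$, the average $\frac1T\int_0^Tf(X_t)\,dt$ is $\widetilde P^{\widetilde\mu}$-integrable, and $$\pm\Big(\widetilde E^{\widetilde\mu}\Big[\frac1T\int_0^Tf(X_t)\,dt\Big]-\mu^*[f]\Big)\le\Xi^\pm(\Lambda,\eta);$$ if $\eta=\infty$ the right-hand side is $+\infty$ and the bound is considered satisfied. 2. $f\in L^2(\mu^*)$, $\Lambda$ is $C^2$ on a neighborhood of $0$, $\Lambda(0)=\Lambda'(0)=0$, $\Lambda''(0)=\beta\operatorname{Var}_{\mu^*}[f]$, and there is a function $r:\mathbb R\to\mathbb R$ (not depending on $\widetilde P$, $\widetilde\mu$, $T$) with $r(\eta)=o(\sqrt\eta)$ as $\eta\searrow0$ and $r(0)=0$, such that $$\Xi^\pm(\Lambda,\eta)\le\sqrt{2\beta\operatorname{Var}_{\mu^*}[f]\,\eta}+r(\eta)\qquad\text{for all }\eta\in[0,\infty).$$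 Consequently, whenever $\eta=\frac1TR(\widetilde P^{\widetilde\mu}_T\|P^{\mu^*}_T)<\infty$, $$\Big|\widetilde E^{\widetilde\mu}\Big[\frac1T\int_0^Tf(X_t)\,dt\Big]-\mu^*[f]\Big|\le\sqrt{2\beta\operatorname{Var}_{\mu^*}[f]\,\eta}+r(\eta).$$ -/

import Mathlib

open MeasureTheory ProbabilityTheory Filter Topology Asymptotics
open scoped NNReal ENNReal

/-- Universal measurability: measurability with respect to the completion of every probability
measure. -/
def UniversallyMeasurable {S : Type*} [MeasurableSpace S] (u : S → ℝ≥0∞) : Prop :=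
  ∀ μ : Measure S, IsProbabilityMeasure μ → AEMeasurable u μ

/-- A family `x ↦ P^x` of probability measures on the sample space of a process `X`, with
`X 0 = x` in law under `P^x`, and with `x ↦ P^x F` universally measurable for every event `F`.
No Markov property is required. -/
structure PathFamily {S Ω : Type*} [MeasurableSpace S] [MeasurableSpace Ω]
    (X : ℝ≥0 → Ω → S) where
  law : S → Measure Ω
  isProb : ∀ x, IsProbabilityMeasure (law x)
  start : ∀ x, (law x).map (X 0) = Measure.dirac x
  univMeas : ∀ F, MeasurableSet F → UniversallyMeasurable (fun x => law x F)

/-- The measure `P^μ (F) = ∫ P^x (F) μ(dx)` of the process with initial distribution `μ`. -/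
noncomputable def PathFamily.init {S Ω : Type*} [MeasurableSpace S] [MeasurableSpace Ω]
    {X : ℝ≥0 → Ω → S} (P : PathFamily X) (μ : Measure S) [hμ : IsProbabilityMeasure μ] :
    Measure Ω :=
  Measure.ofMeasurable (fun F _ => ∫⁻ x, P.law x F ∂μ) (by simp) (by
    intro F hF hd
    have h : ∀ x, P.law x (⋃ i, F i) = ∑' i, P.law x (F i) := fun x => measure_iUnion hd hF
    simp only [h]
    exact lintegral_tsum fun i => P.univMeas (F i) (hF i) μ hμ)

theorem PathFamily.init_apply {S Ω : Type*} [MeasurableSpace S] [MeasurableSpace Ω]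
    {X : ℝ≥0 → Ω → S} (P : PathFamily X) (μ : Measure S) [IsProbabilityMeasure μ]
    {F : Set Ω} (hF : MeasurableSet F) : P.init μ F = ∫⁻ x, P.law x F ∂μ :=
  Measure.ofMeasurable_apply F hF

/-- Every path is right-continuous and has left limits. -/
def IsCadlag {S Ω : Type*} [TopologicalSpace S] (X : ℝ≥0 → Ω → S) : Prop :=
  ∀ ω, ∀ t : ℝ≥0, Tendsto (fun s => X s ω) (𝓝[>] t) (𝓝 (X t ω)) ∧
    (0 < t → ∃ l : S, Tendsto (fun s => X s ω) (𝓝[<] t) (𝓝 l))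

/-- `(Ω, ℱ, ℱ_t, X_t, P^x)` is a time homogeneous càdlàg Markov family with transition
probabilities `p t x`. Transition kernels which are Borel measurable in `x` are a special case. -/
structure IsMarkovFamily {S Ω : Type*} [TopologicalSpace S] [MeasurableSpace S]
    [mΩ : MeasurableSpace Ω] (ℱ : Filtration ℝ≥0 mΩ) (X : ℝ≥0 → Ω → S)
    (p : ℝ≥0 → S → Measure S) (P : PathFamily X) : Prop where
  adapted : Adapted ℱ X
  cadlag : IsCadlag X
  transProb : ∀ t x, IsProbabilityMeasure (p t x)
  transMeas : ∀ t B, MeasurableSet B → UniversallyMeasurable (fun x => p t x B)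
  markov : ∀ x s t B, MeasurableSet B →
    (P.law x)⟦X (t + s) ⁻¹' B | ℱ s⟧ =ᵐ[P.law x] fun ω => (p t (X s ω)).real B

/-- `μ` is invariant for the transition probabilities `p`. -/
def IsInvariantMeasure {S : Type*} [MeasurableSpace S] (p : ℝ≥0 → S → Measure S) (μ : Measure S) :
    Prop :=
  ∀ t B, MeasurableSet B → ∫⁻ x, p t x B ∂μ = μ B

/-- `g ∈ D(A, ℝ)` and `A g = h`, where `A` is the generator on `L²(μ)` of the semigroup
`(𝒫_t g)(x) = ∫ g(y) p_t(x, dy)`: the difference quotients `(𝒫_t g - g) / t` converge to `h` in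
`L²(μ)` as `t ↘ 0`. Elements of `L²(μ)` are given by representatives. -/
def GeneratorGraph {S : Type*} [MeasurableSpace S] (p : ℝ≥0 → S → Measure S) (μ : Measure S)
    (g h : S → ℝ) : Prop :=
  MemLp g 2 μ ∧ MemLp h 2 μ ∧
    Tendsto (fun t : ℝ≥0 => eLpNorm (fun x => ((∫ y, g y ∂(p t x)) - g x) / (t : ℝ) - h x) 2 μ)
      (𝓝[>] 0) (𝓝 0)

/-- The log-Sobolev inequality `∫ g² log(g²) dμ ≤ -β ∫ A[g] g dμ` for all `g ∈ D(A, ℝ)` with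
`‖g‖_{L²(μ)} = 1`. The function `g² log(g²)` is bounded below, so its integral always exists in
`(-∞, ∞]`, and the inequality includes that it is finite. -/
def LogSobolev {S : Type*} [MeasurableSpace S] (p : ℝ≥0 → S → Measure S) (μ : Measure S)
    (β : ℝ) : Prop :=
  ∀ g h : S → ℝ, GeneratorGraph p μ g h → ∫ x, g x ^ 2 ∂μ = 1 →
    Integrable (fun x => g x ^ 2 * Real.log (g x ^ 2)) μ ∧
      ∫ x, g x ^ 2 * Real.log (g x ^ 2) ∂μ ≤ -β * ∫ x, h x * g x ∂μ

/-- The centered and scaled observable `V_c = c (f - μ[f])`. -/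
noncomputable def centered {S : Type*} [MeasurableSpace S] (μ : Measure S) (f : S → ℝ) (c : ℝ) :
    S → ℝ :=
  fun x => c * (f x - ∫ y, f y ∂μ)

/-- `β⁻¹ log ∫ exp(β V_c) dμ`. -/
noncomputable def logMoment {S : Type*} [MeasurableSpace S] (μ : Measure S) (β : ℝ) (f : S → ℝ)
    (c : ℝ) : ℝ :=
  1 / β * Real.log (∫ x, Real.exp (β * centered μ f c x) ∂μ)

open Classical in
/-- `Λ(c) = β⁻¹ log ∫ exp(β V_c) dμ` for `c ∈ (c₋, c₊)`, and `Λ(c) = +∞` otherwise. -/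
noncomputable def lambdaLS {S : Type*} [MeasurableSpace S] (μ : Measure S) (β : ℝ) (f : S → ℝ)
    (cm cp : EReal) (c : ℝ) : EReal :=
  if cm < (c : EReal) ∧ (c : EReal) < cp then ((logMoment μ β f c : ℝ) : EReal) else ⊤

/-- `Ξ⁺(Λ, η) = inf_{c > 0} (Λ(c) + η) / c`. -/
noncomputable def XiPlus (Λ : ℝ → EReal) (η : EReal) : EReal :=
  ⨅ (c : ℝ) (_ : 0 < c), (Λ c + η) / (c : EReal)

/-- `Ξ⁻(Λ, η) = inf_{c > 0} (Λ(-c) + η) / c`. -/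
noncomputable def XiMinus (Λ : ℝ → EReal) (η : EReal) : EReal :=
  ⨅ (c : ℝ) (_ : 0 < c), (Λ (-c) + η) / (c : EReal)

/-- The finite-time average `(1/T) ∫₀ᵀ f(X_t) dt`. -/
noncomputable def timeAvg {S Ω : Type*} (X : ℝ≥0 → Ω → S) (f : S → ℝ) (T : ℝ≥0) (ω : Ω) : ℝ :=
  1 / (T : ℝ) * ∫ t in (0 : ℝ)..(T : ℝ), f (X t.toNNReal ω)

/-- The relative entropy `R(Q_T ‖ P_T) ∈ [0, ∞]` of the restrictions to `ℱ_T` of two probability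
measures. -/
noncomputable def relEntropy {Ω : Type*} [mΩ : MeasurableSpace Ω] (ℱ : Filtration ℝ≥0 mΩ)
    (T : ℝ≥0) (Q P : Measure Ω) : ℝ≥0∞ :=
  InformationTheory.klDiv (Q.trim (ℱ.le T)) (P.trim (ℱ.le T))

/-! Fix `V = c (f - μ[f])` and `κ = β⁻¹ log ∫ exp(β V) dμ`. Everything rests on one exponential
moment bound for the stationary process: `E exp(∫₀ᵀ V(X_t) dt) ≤ exp(T κ)`.

For bounded continuous `V` put `u_t(x) = E^x exp(∫₀ᵗ V(X_s) ds)`. By the Markov property `𝒫_h u_t(x)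
= E^x exp(∫ V(X_s) ds)` over the window `[h, h + t]`. Differentiating from the right at `h = 0`
shows that `u_t` lies in the domain of `A`, with `A u_t = ∂_t u_t - V u_t`
(`IsMarkovFamily.generatorGraph_feynmanKac`). Hence `d/dt ‖u_t‖² = 2 ⟨(A + V) u_t, u_t⟩`. The
log-Sobolev inequality combined with the duality between entropy and exponential moments bounds this
by `2 κ ‖u_t‖²` (`LogSobolev.integral_mul_le`). Grönwall and `∫ u_T dμ ≤ ‖u_T‖` give the claim.
Invariance makes path integrals continuous in the `L¹(μ)` norm of the observable, so Fatou extends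
the bound to unbounded `V` (`IsMarkovFamily.lintegral_init_exp_le`).

The Gibbs variational inequality on `ℱ_T` then bounds `c T` times the bias of the time average by
the relative entropy plus `T Λ(c)` (`IsMarkovFamily.uq_bound`). Dividing by `|c| T` and optimising
over each sign of `c` yields `Ξ^±`.

Finally `Λ` is a rescaled cumulant generating function, so `Λ(c) ≤ (v + δ) c² / 2` near `0` with `v
= β Var[f]`. The choice `c = √(2η / (v + δ))` gives `√(2 (v + δ) η)`, and `δ` is arbitrary
(`exists_isLittleO_XiPlus_le`). -/

set_option linter.unusedSectionVars false

/-! ### Measurability and Riemann sums for right-continuous functions; measure-valued maps. -/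

/-- The grid points `⌈n r⌉ / n` converge to `r` from the right. -/
theorem tendsto_ceil_mul_div_nhdsGE (r : ℝ≥0) :
    Tendsto (fun n : ℕ => (⌈((n : ℝ≥0) + 1) * r⌉₊ : ℝ≥0) / ((n : ℝ≥0) + 1)) atTop (𝓝[≥] r) := by
  refine tendsto_nhdsWithin_iff.2 ⟨?_, Eventually.of_forall fun n => ?_⟩
  · have h1 : Tendsto (fun n : ℕ => r + 1 / ((n : ℝ≥0) + 1)) atTop (𝓝 r) := by
      simpa using (tendsto_const_nhds (x := r)).add
        (tendsto_one_div_add_atTop_nhds_zero_nat (𝕜 := ℝ≥0))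
    refine tendsto_of_tendsto_of_tendsto_of_le_of_le tendsto_const_nhds h1 (fun n => ?_)
      (fun n => ?_)
    · have hn : (0 : ℝ≥0) < (n : ℝ≥0) + 1 := by positivity
      simp only
      rw [le_div_iff₀ hn, mul_comm]
      exact Nat.le_ceil _
    · have hn : (0 : ℝ≥0) < (n : ℝ≥0) + 1 := by positivity
      simp only
      rw [div_le_iff₀ hn, add_mul r, one_div_mul_cancel hn.ne', mul_comm r]
      exact (Nat.ceil_lt_add_one (zero_le)).le
  · have hn : (0 : ℝ≥0) < (n : ℝ≥0) + 1 := by positivity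
    simp only [Set.mem_Ici]
    rw [le_div_iff₀ hn, mul_comm]
    exact Nat.le_ceil _

/-- A right-continuous process with measurable marginals is jointly measurable. -/
theorem measurable_uncurry_of_rightContinuous {S Ω : Type*} [TopologicalSpace S]
    [TopologicalSpace.PseudoMetrizableSpace S] [MeasurableSpace S] [BorelSpace S]
    [MeasurableSpace Ω] {Y : ℝ≥0 → Ω → S} (hm : ∀ t, Measurable (Y t))
    (hc : ∀ ω t, ContinuousWithinAt (fun s => Y s ω) (Set.Ici t) t) :
    Measurable fun q : ℝ≥0 × Ω => Y q.1 q.2 := by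
  refine measurable_of_tendsto_metrizable
    (f := fun (n : ℕ) (q : ℝ≥0 × Ω) =>
      Y ((⌈((n : ℝ≥0) + 1) * q.1⌉₊ : ℝ≥0) / ((n : ℝ≥0) + 1)) q.2) (fun n => ?_) ?_
  · have h1 : Measurable fun q : ℕ × Ω => Y ((q.1 : ℝ≥0) / ((n : ℝ≥0) + 1)) q.2 :=
      measurable_from_prod_countable_right fun k => hm ((k : ℝ≥0) / ((n : ℝ≥0) + 1))
    have h2 : Measurable fun q : ℝ≥0 × Ω => (⌈((n : ℝ≥0) + 1) * q.1⌉₊, q.2) :=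
      (Nat.measurable_ceil.comp (measurable_const.mul measurable_fst)).prodMk measurable_snd
    exact h1.comp h2
  · rw [tendsto_pi_nhds]
    exact fun q => (hc q.2 q.1).tendsto.comp (tendsto_ceil_mul_div_nhdsGE q.1)

/-- Right-endpoint Riemann sums of a bounded measurable right-continuous function on `[0, 1]`. -/
theorem tendsto_riemannSum_right_unit {w : ℝ → ℝ} (hw : Measurable w) {M : ℝ}
    (hM : ∀ r, |w r| ≤ M) (hc : ∀ r, 0 ≤ r → ContinuousWithinAt w (Set.Ici r) r) :
    Tendsto (fun n : ℕ => ∑ i ∈ Finset.range (n + 1),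
      1 / ((n : ℝ) + 1) * w (((i : ℝ) + 1) / ((n : ℝ) + 1))) atTop
      (𝓝 (∫ r in (0 : ℝ)..1, w r)) := by
  -- This step function samples `w` at the right end of each grid cell. Its integral is exactly the
  -- Riemann sum, and right-continuity gives pointwise convergence, so dominated convergence
  -- applies.
  set F : ℕ → ℝ → ℝ := fun n r => w ((⌈((n : ℝ) + 1) * r⌉₊ : ℝ) / ((n : ℝ) + 1)) with hF
  have hFm : ∀ n, Measurable (F n) := fun n => hw.comp
    ((measurable_from_nat.comp (Nat.measurable_ceil.comp
      (measurable_const.mul measurable_id))).div_const _ :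
      Measurable fun r : ℝ => (⌈((n : ℝ) + 1) * r⌉₊ : ℝ) / ((n : ℝ) + 1))
  have hsum : ∀ n : ℕ, ∑ i ∈ Finset.range (n + 1),
      1 / ((n : ℝ) + 1) * w (((i : ℝ) + 1) / ((n : ℝ) + 1)) = ∫ r in (0 : ℝ)..1, F n r := by
    intro n
    have hn : (0 : ℝ) < (n : ℝ) + 1 := by positivity
    have hint : ∀ a b, IntervalIntegrable (F n) volume a b := fun a b =>
      (intervalIntegrable_const (c := M)).mono_fun (hFm n).aestronglyMeasurable
        (Eventually.of_forall fun r => (hM _).trans (le_abs_self M))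
    have := intervalIntegral.sum_integral_adjacent_intervals (μ := volume) (f := F n)
      (a := fun i : ℕ => (i : ℝ) / ((n : ℝ) + 1)) (n := n + 1) (fun k _ => hint _ _)
    simp only [Nat.cast_zero, zero_div, Nat.cast_add, Nat.cast_one, div_self hn.ne'] at this
    rw [← this]
    refine Finset.sum_congr rfl fun i _ => ?_
    have hle : (i : ℝ) / ((n : ℝ) + 1) ≤ ((i : ℝ) + 1) / ((n : ℝ) + 1) := by gcongr; linarith
    rw [intervalIntegral.integral_congr_ae (g := fun _ => w (((i : ℝ) + 1) / ((n : ℝ) + 1)))]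
    · rw [intervalIntegral.integral_const, smul_eq_mul]
      congr 1
      ring
    · refine Eventually.of_forall fun r hr => ?_
      rw [Set.uIoc_of_le hle, Set.mem_Ioc, div_lt_iff₀ hn, le_div_iff₀ hn] at hr
      have : ⌈((n : ℝ) + 1) * r⌉₊ = i + 1 := by
        rw [Nat.ceil_eq_iff (by omega)]
        push_cast
        constructor <;> linarith
      simp only [hF, this]
      push_cast
      rfl
  simp only [hsum]
  refine intervalIntegral.tendsto_integral_filter_of_dominated_convergence (fun _ => M)
    (Eventually.of_forall fun n => (hFm n).aestronglyMeasurable)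
    (Eventually.of_forall fun n => Eventually.of_forall fun r _ => hM _)
    intervalIntegrable_const (Eventually.of_forall fun r hr => ?_)
  rw [Set.uIoc_of_le zero_le_one] at hr
  refine (hc r hr.1.le).tendsto.comp ?_
  lift r to ℝ≥0 using hr.1.le
  have h := tendsto_ceil_mul_div_nhdsGE r
  have h2 := tendsto_nhdsWithin_iff.1 h
  refine tendsto_nhdsWithin_iff.2 ⟨?_, ?_⟩
  · have := (NNReal.continuous_coe.tendsto r).comp h2.1
    refine this.congr fun n => ?_
    simp only [Function.comp, NNReal.coe_div, NNReal.coe_natCast, NNReal.coe_add, NNReal.coe_one]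
    have : ⌈((n : ℝ≥0) + 1) * r⌉₊ = ⌈((n : ℝ) + 1) * r⌉₊ :=
      le_antisymm (Nat.ceil_le.2 (by exact_mod_cast Nat.le_ceil (((n : ℝ) + 1) * r)))
        (Nat.ceil_le.2 (by exact_mod_cast Nat.le_ceil (((n : ℝ≥0) + 1) * r)))
    rw [this]
  · refine Eventually.of_forall fun n => ?_
    have hn : (0 : ℝ) < (n : ℝ) + 1 := by positivity
    rw [Set.mem_Ici, le_div_iff₀ hn, mul_comm]
    exact Nat.le_ceil _

theorem tendsto_riemannSum_right {v : ℝ → ℝ} (hv : Measurable v) {M : ℝ}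
    (hM : ∀ r, |v r| ≤ M) {s : ℝ} (hc : ∀ r, s ≤ r → ContinuousWithinAt v (Set.Ici r) r)
    {t : ℝ} (ht : 0 ≤ t) :
    Tendsto (fun n : ℕ => ∑ i ∈ Finset.range (n + 1),
      t / ((n : ℝ) + 1) * v (s + ((i : ℝ) + 1) * (t / ((n : ℝ) + 1)))) atTop
      (𝓝 (∫ r in s..(s + t), v r)) := by
  rcases ht.eq_or_lt with rfl | ht
  · simp
  have h := tendsto_riemannSum_right_unit (w := fun r => v (s + t * r))
    (hv.comp (measurable_const.add (measurable_const.mul measurable_id))) (fun r => hM _)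
    (fun r hr => by
      refine (hc (s + t * r) (by nlinarith)).comp (t := Set.Ici (s + t * r)) (by fun_prop)
        fun x hx => ?_
      simp only [Set.mem_Ici] at hx ⊢
      gcongr)
  have h2 := h.const_mul t
  rw [intervalIntegral.integral_comp_add_mul v ht.ne' s, smul_eq_mul, mul_zero, add_zero, mul_one,
    ← mul_assoc, mul_inv_cancel₀ ht.ne', one_mul] at h2
  refine h2.congr fun n => ?_
  rw [Finset.mul_sum]
  refine Finset.sum_congr rfl fun i _ => ?_
  rw [← mul_assoc]
  congr 2 <;> ring_nf

/-- A setwise almost everywhere measurable family of probability measures on a countably generated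
space is almost everywhere measurable as a measure-valued map. -/
theorem aemeasurable_measure_of_forall_aemeasurable {α β : Type*} [MeasurableSpace α]
    [MeasurableSpace β] [MeasurableSpace.CountablyGenerated β] {κ : α → Measure β}
    [∀ a, IsProbabilityMeasure (κ a)] {ν : Measure α}
    (h : ∀ B, MeasurableSet B → AEMeasurable (fun a => κ a B) ν) : AEMeasurable κ ν := by
  rcases isEmpty_or_nonempty α with hα | ⟨⟨a₀⟩⟩
  · exact (measurable_of_empty κ).aemeasurable
  -- The exceptional null set of `h B` depends on `B`. A countable generating algebra allows these
  -- null sets to be united, and it is a π-system, so it suffices for measurability of the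
  -- measure-valued map.
  set C := generateSetAlgebra (MeasurableSpace.countableGeneratingSet β) with hC
  have hCc : C.Countable :=
    countable_generateSetAlgebra MeasurableSpace.countable_countableGeneratingSet
  have hgen : ‹MeasurableSpace β› = .generateFrom C := by
    rw [hC, generateFrom_generateSetAlgebra_eq, MeasurableSpace.generateFrom_countableGeneratingSet]
  have hCm : ∀ B ∈ C, MeasurableSet B := fun B hB => by
    rw [hgen]
    exact MeasurableSpace.measurableSet_generateFrom hB
  have hCpi : IsPiSystem C := fun s hs t ht _ => isSetAlgebra_generateSetAlgebra.inter_mem hs ht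
  have hae : ∀ᵐ a ∂ν, ∀ B (hB : B ∈ C), κ a B = (h B (hCm B hB)).mk _ a := by
    rw [ae_ball_iff hCc]
    exact fun B hB => (h B (hCm B hB)).ae_eq_mk
  set N := toMeasurable ν {a | ¬ ∀ B (hB : B ∈ C), κ a B = (h B (hCm B hB)).mk _ a} with hN
  have hNm : MeasurableSet N := measurableSet_toMeasurable _ _
  have hN0 : ν N = 0 := by rw [hN, measure_toMeasurable]; exact hae
  classical
  -- On the null set a fixed `κ a₀` is substituted, so that all values remain probability measures,
  -- as the π-system criterion requires.
  refine ⟨fun a => if a ∈ N then κ a₀ else κ a, ?_, ?_⟩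
  · have : ∀ a, IsProbabilityMeasure (if a ∈ N then κ a₀ else κ a) := fun a => by
      split_ifs <;> infer_instance
    refine Measurable.measure_of_isPiSystem_of_isProbabilityMeasure hgen hCpi
      fun B hB => ?_
    have : (fun a => (if a ∈ N then κ a₀ else κ a) B) =
        fun a => if a ∈ N then κ a₀ B else (h B (hCm B hB)).mk _ a := by
      ext a
      split_ifs with ha
      · rfl
      · have : a ∉ {a | ¬ ∀ B (hB : B ∈ C), κ a B = (h B (hCm B hB)).mk _ a} :=
          fun h' => ha (subset_toMeasurable _ _ h')
        rw [Set.mem_ofPred_eq, not_not] at this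
        exact this B hB
    rw [this]
    exact Measurable.ite hNm measurable_const (h B (hCm B hB)).measurable_mk
  · filter_upwards [measure_eq_zero_iff_ae_notMem.1 hN0] with a ha
    simp [ha]

/-! ### The Markov property: from single times to products over a time grid. -/

section Markov

variable {S Ω : Type*} [TopologicalSpace S] [PolishSpace S] [MeasurableSpace S] [BorelSpace S]
  [mΩ : MeasurableSpace Ω] {ℱ : Filtration ℝ≥0 mΩ} {X : ℝ≥0 → Ω → S} {p : ℝ≥0 → S → Measure S}
  {P : PathFamily X}

theorem IsMarkovFamily.measurable (hP : IsMarkovFamily ℱ X p P) (t : ℝ≥0) : Measurable (X t) :=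
  (hP.adapted t).mono (ℱ.le t) le_rfl

theorem IsMarkovFamily.aemeasurable_trans (hP : IsMarkovFamily ℱ X p P) (t : ℝ≥0) (ν : Measure S)
    [IsProbabilityMeasure ν] : AEMeasurable (p t) ν :=
  have := hP.transProb t
  aemeasurable_measure_of_forall_aemeasurable fun B hB => hP.transMeas t B hB ν ‹_›

theorem IsMarkovFamily.ae_start (hP : IsMarkovFamily ℱ X p P) (x : S) :
    ∀ᵐ ω ∂P.law x, X 0 ω = x := by
  have : ∀ᵐ y ∂(P.law x).map (X 0), y = x := by
    rw [P.start x, ae_dirac_eq]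
    exact rfl
  exact ae_of_ae_map (hP.measurable 0).aemeasurable this

/-- Integrating the conditional probability over a past event removes the conditional expectation.
All later uses of the Markov property pass through this identity. -/
theorem IsMarkovFamily.measure_inter_preimage (hP : IsMarkovFamily ℱ X p P) (x : S) (s t : ℝ≥0)
    {A : Set Ω} (hA : MeasurableSet[ℱ s] A) {B : Set S} (hB : MeasurableSet B) :
    P.law x (A ∩ X (t + s) ⁻¹' B) = ∫⁻ ω in A, p t (X s ω) B ∂P.law x := by
  have := P.isProb x
  have := hP.transProb t
  have hA' := ℱ.le s A hA
  have hBm : MeasurableSet (X (t + s) ⁻¹' B) := hP.measurable (t + s) hB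
  have : IsProbabilityMeasure ((P.law x).map (X s)) :=
    Measure.isProbabilityMeasure_map (hP.measurable s).aemeasurable
  have hm : AEMeasurable (fun ω => p t (X s ω) B) (P.law x) :=
    (hP.transMeas t B hB _ this).comp_measurable (hP.measurable s)
  have h1 := setIntegral_condExp (μ := P.law x) (ℱ.le s)
    (f := (X (t + s) ⁻¹' B).indicator fun _ => (1 : ℝ))
    ((integrable_const 1).indicator hBm) hA
  rw [setIntegral_congr_ae hA' ((hP.markov x s t B hB).mono fun ω h _ => h),
    setIntegral_indicator hBm] at h1
  simp only [integral_const, smul_eq_mul, mul_one, measureReal_restrict_apply_univ] at h1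
  simp only [Measure.real] at h1
  rw [integral_toReal hm.restrict (Eventually.of_forall fun ω => measure_lt_top _ _)] at h1
  refine ((ENNReal.toReal_eq_toReal_iff' ?_ (measure_ne_top _ _)).1 h1).symm
  refine ne_of_lt (lt_of_le_of_lt (lintegral_mono (g := fun _ => 1) fun ω => prob_le_one) ?_)
  simp

/-- The law of `X_t` under `P^x`. -/
theorem IsMarkovFamily.map_law (hP : IsMarkovFamily ℱ X p P) (x : S) (t : ℝ≥0) :
    (P.law x).map (X t) = p t x := by
  have := P.isProb x
  ext B hB
  rw [Measure.map_apply (hP.measurable t) hB]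
  have := hP.measure_inter_preimage x 0 t (A := Set.univ) MeasurableSet.univ hB
  simp only [Set.univ_inter, add_zero, Measure.restrict_univ] at this
  rw [this, lintegral_congr_ae (g := fun _ => p t x B) ((hP.ae_start x).mono fun ω h => by simp only [h])]
  simp

/-- The Markov property for universally measurable functions. -/
theorem IsMarkovFamily.lintegral_mul_comp (hP : IsMarkovFamily ℱ X p P) (x : S) (s t : ℝ≥0)
    {G : S → ℝ≥0∞} (hG : UniversallyMeasurable G) {Z : Ω → ℝ≥0∞} (hZ : Measurable[ℱ s] Z) :
    ∫⁻ ω, Z ω * G (X (t + s) ω) ∂P.law x = ∫⁻ ω, Z ω * ∫⁻ y, G y ∂p t (X s ω) ∂P.law x := by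
  have := P.isProb x
  have := hP.transProb t
  have : ∀ r, IsProbabilityMeasure ((P.law x).map (X r)) := fun r =>
    Measure.isProbabilityMeasure_map (hP.measurable r).aemeasurable
  have hGm : AEMeasurable (fun ω => G (X (t + s) ω)) (P.law x) :=
    (hG _ (this (t + s))).comp_measurable (hP.measurable _)
  have hpm : AEMeasurable (p t) ((P.law x).map (X s)) := hP.aemeasurable_trans t _
  -- On each past event the law of `X (t + s)` is a mixture of the kernels `p t`. This equality of
  -- measures lets a merely universally measurable `G` be replaced by a Borel version for almost
  -- every kernel.
  have hbind : ∀ A, MeasurableSet[ℱ s] A →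
      ((P.law x).restrict A).map (X (t + s)) = (((P.law x).restrict A).map (X s)).bind (p t) := by
    intro A hA
    have hle : AEMeasurable (p t) (((P.law x).restrict A).map (X s)) :=
      hpm.mono_measure (Measure.map_mono Measure.restrict_le_self (hP.measurable s))
    ext B hB
    rw [Measure.bind_apply hB hle, lintegral_map' _ (hP.measurable s).aemeasurable,
      ← hP.measure_inter_preimage x s t hA hB, Measure.map_apply (hP.measurable _) hB,
      Measure.restrict_apply (hP.measurable _ hB), Set.inter_comm]
    exact (Measure.measurable_coe hB).comp_aemeasurable hle
  have hKm : AEMeasurable (fun ω => ∫⁻ y, G y ∂p t (X s ω)) (P.law x) := by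
    have h1 := hbind Set.univ MeasurableSet.univ
    rw [Measure.restrict_univ] at h1
    have hG' : AEMeasurable G (((P.law x).map (X s)).bind (p t)) := h1 ▸ hG _ (this _)
    obtain ⟨G', hG'm, hGG'⟩ := hG'
    have h2 : AEMeasurable (fun y => ∫⁻ z, G' z ∂p t y) ((P.law x).map (X s)) :=
      (Measure.measurable_lintegral hG'm).comp_aemeasurable hpm
    refine AEMeasurable.comp_measurable (g := fun y => ∫⁻ z, G z ∂p t y) (h2.congr ?_)
      (hP.measurable s)
    filter_upwards [Measure.ae_ae_of_ae_bind hpm hGG'] with y hy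
    exact (lintegral_congr_ae hy).symm
  refine Measurable.ennreal_induction (mα := ℱ s) (motive := fun Z =>
    ∫⁻ ω, Z ω * G (X (t + s) ω) ∂P.law x = ∫⁻ ω, Z ω * ∫⁻ y, G y ∂p t (X s ω) ∂P.law x)
    ?_ ?_ ?_ hZ
  · intro c A hA
    have hA' := ℱ.le s A hA
    have hle : AEMeasurable (p t) (((P.law x).restrict A).map (X s)) :=
      hpm.mono_measure (Measure.map_mono Measure.restrict_le_self (hP.measurable s))
    have hind : ∀ (g : Ω → ℝ≥0∞), AEMeasurable g (P.law x) →
        ∫⁻ ω, A.indicator (fun _ => c) ω * g ω ∂P.law x = c * ∫⁻ ω in A, g ω ∂P.law x := by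
      intro g hg
      rw [← lintegral_const_mul'' c hg.restrict, ← lintegral_indicator hA']
      congr 1 with ω
      by_cases hω : ω ∈ A <;> simp [hω]
    have hGA : AEMeasurable G (((P.law x).restrict A).map (X (t + s))) :=
      (hG _ (this _)).mono_measure (Measure.map_mono Measure.restrict_le_self (hP.measurable _))
    rw [hind _ hGm, hind _ hKm]
    congr 1
    rw [← lintegral_map' (f := G) (g := X (t + s)) hGA (hP.measurable _).aemeasurable, hbind A hA,
      Measure.lintegral_bind hle (hbind A hA ▸ hGA), lintegral_map' _ (hP.measurable s).aemeasurable]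
    have hGA' := hbind A hA ▸ hGA
    obtain ⟨G', hG'm, hGG'⟩ := hGA'
    refine ((Measure.measurable_lintegral hG'm).comp_aemeasurable hle).congr ?_
    filter_upwards [Measure.ae_ae_of_ae_bind hle hGG'] with y hy
    exact (lintegral_congr_ae hy).symm
  · intro Z₁ Z₂ _ h1 h2 e1 e2
    simp only [Pi.add_apply, add_mul]
    have hadd : ∀ g : Ω → ℝ≥0∞, AEMeasurable g (P.law x) →
        ∫⁻ ω, Z₁ ω * g ω + Z₂ ω * g ω ∂P.law x =
          ∫⁻ ω, Z₁ ω * g ω ∂P.law x + ∫⁻ ω, Z₂ ω * g ω ∂P.law x := fun g hg =>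
      lintegral_add_left' ((h1.mono (ℱ.le s) le_rfl).aemeasurable.mul hg) _
    rw [hadd _ hGm, hadd _ hKm, e1, e2]
  · intro Zn hm hmono he
    simp only [ENNReal.iSup_mul]
    have hsup : ∀ g : Ω → ℝ≥0∞, AEMeasurable g (P.law x) →
        ∫⁻ ω, ⨆ n, Zn n ω * g ω ∂P.law x = ⨆ n, ∫⁻ ω, Zn n ω * g ω ∂P.law x := fun g hg =>
      lintegral_iSup' (fun n => ((hm n).mono (ℱ.le s) le_rfl).aemeasurable.mul hg)
        (Eventually.of_forall fun ω i j hij => mul_le_mul_left (hmono hij ω) _)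
    rw [hsup _ hGm, hsup _ hKm]
    simp only [he]

theorem PathFamily.universallyMeasurable_lintegral (P : PathFamily X) {Y : Ω → ℝ≥0∞}
    (hY : Measurable Y) : UniversallyMeasurable fun x => ∫⁻ ω, Y ω ∂P.law x := by
  intro ν hν
  refine hY.ennreal_induction (motive := fun Y => AEMeasurable (fun x => ∫⁻ ω, Y ω ∂P.law x) ν)
    ?_ ?_ ?_
  · intro c A hA
    simp only [lintegral_indicator_const hA]
    exact (P.univMeas A hA ν hν).const_mul c
  · intro Y₁ Y₂ _ h1 _ e1 e2
    simp only [Pi.add_apply, lintegral_add_left h1]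
    exact e1.add e2
  · intro Yn hm hmono he
    simp only [lintegral_iSup hm hmono]
    exact AEMeasurable.iSup he

theorem PathFamily.lintegral_init (P : PathFamily X) (ν : Measure S) [hν : IsProbabilityMeasure ν]
    {Y : Ω → ℝ≥0∞} (hY : Measurable Y) :
    ∫⁻ ω, Y ω ∂P.init ν = ∫⁻ x, ∫⁻ ω, Y ω ∂P.law x ∂ν := by
  refine hY.ennreal_induction (motive := fun Y =>
    ∫⁻ ω, Y ω ∂P.init ν = ∫⁻ x, ∫⁻ ω, Y ω ∂P.law x ∂ν) ?_ ?_ ?_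
  · intro c A hA
    simp only [lintegral_indicator_const hA]
    rw [lintegral_const_mul'' c (P.univMeas A hA ν hν), P.init_apply ν hA]
  · intro Y₁ Y₂ _ h1 _ e1 e2
    simp only [Pi.add_apply, lintegral_add_left h1]
    rw [lintegral_add_left' (P.universallyMeasurable_lintegral h1 ν hν), e1, e2]
  · intro Yn hm hmono he
    simp only [lintegral_iSup hm hmono]
    rw [lintegral_iSup' (fun n => P.universallyMeasurable_lintegral (hm n) ν hν)
      (Eventually.of_forall fun x i j hij => lintegral_mono (hmono hij))]
    simp only [he]

theorem PathFamily.isProbabilityMeasure_init (P : PathFamily X) (ν : Measure S)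
    [IsProbabilityMeasure ν] : IsProbabilityMeasure (P.init ν) := by
  have := P.isProb
  constructor
  rw [P.init_apply ν MeasurableSet.univ]
  simp

/-- Multiplicative functionals over a time grid: the Markov property at time `s`. -/
theorem IsMarkovFamily.lintegral_mul_prod (hP : IsMarkovFamily ℱ X p P) {φ : S → ℝ≥0∞}
    (hφ : Measurable φ) (h : ℝ≥0) (n : ℕ) (x : S) (s : ℝ≥0) {Z : Ω → ℝ≥0∞}
    (hZ : Measurable[ℱ s] Z) :
    ∫⁻ ω, Z ω * ∏ i ∈ Finset.range n, φ (X (s + ((i : ℝ≥0) + 1) * h) ω) ∂P.law x =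
      ∫⁻ ω, Z ω * ∫⁻ ω', ∏ i ∈ Finset.range n, φ (X (((i : ℝ≥0) + 1) * h) ω') ∂P.law (X s ω)
        ∂P.law x := by
  have := P.isProb
  induction n generalizing x s Z with
  | zero => simp
  | succ n ih =>
    -- One grid step is peeled off: given the position at the first grid point, the whole product
    -- has conditional expectation `G`. It is only universally measurable, because `x ↦ P^x` is.
    set G : S → ℝ≥0∞ := fun y =>
      φ y * ∫⁻ ω', ∏ i ∈ Finset.range n, φ (X (((i : ℝ≥0) + 1) * h) ω') ∂P.law y with hG
    have hGm : UniversallyMeasurable G := fun ν hν => hφ.aemeasurable.mul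
      (P.universallyMeasurable_lintegral
        (Finset.measurable_prod _ fun i _ => hφ.comp (hP.measurable _)) ν hν)
    have key : ∀ (x : S) (s : ℝ≥0) (Z : Ω → ℝ≥0∞), Measurable[ℱ s] Z →
        ∫⁻ ω, Z ω * ∏ i ∈ Finset.range (n + 1), φ (X (s + ((i : ℝ≥0) + 1) * h) ω) ∂P.law x =
          ∫⁻ ω, Z ω * ∫⁻ y, G y ∂p h (X s ω) ∂P.law x := by
      intro x s Z hZ
      rw [← hP.lintegral_mul_comp x s h hGm hZ]
      have := ih x (h + s) (Z := fun ω => Z ω * φ (X (h + s) ω))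
        ((hZ.mono (ℱ.mono (by simp)) le_rfl).mul (hφ.comp (hP.adapted (h + s))))
      simp only [mul_assoc] at this
      rw [← this]
      congr 1 with ω
      rw [Finset.prod_range_succ', mul_comm (∏ i ∈ _, _)]
      congr 2
      · rw [Nat.cast_zero, zero_add, one_mul, add_comm]
      · refine Finset.prod_congr rfl fun i _ => ?_
        congr 2
        push_cast
        ring
    rw [key x s Z hZ]
    congr 1 with ω
    congr 1
    -- The same identity, restarted at time `0` from the point `X s ω`, identifies the kernel
    -- integral of `G` with the grid expectation under `P.law (X s ω)`.
    have h0 := key (X s ω) 0 (fun _ => 1) (@measurable_const _ _ _ (ℱ 0) _)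
    simp only [one_mul, zero_add] at h0
    rw [h0]
    rw [lintegral_congr_ae (g := fun _ => ∫⁻ y, G y ∂p h (X s ω))
      ((hP.ae_start _).mono fun ω' h' => by simp only [h'])]
    simp

end Markov

/-! ### Elementary inequalities and dominated convergence. -/

theorem abs_exp_sub_exp_le {a b K : ℝ} (ha : |a| ≤ K) (hb : |b| ≤ K) :
    |Real.exp a - Real.exp b| ≤ Real.exp K * |a - b| := by
  wlog h : b ≤ a generalizing a b
  · rw [abs_sub_comm, abs_sub_comm a]
    exact this hb ha (le_of_not_ge h)
  rw [abs_of_nonneg (sub_nonneg.2 (Real.exp_le_exp.2 h)), abs_of_nonneg (sub_nonneg.2 h)]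
  have h1 : Real.exp b = Real.exp a * Real.exp (b - a) := by rw [← Real.exp_add]; ring_nf
  have h2 := Real.add_one_le_exp (b - a)
  have h3 : Real.exp a ≤ Real.exp K := Real.exp_le_exp.2 ((le_abs_self a).trans ha)
  calc Real.exp a - Real.exp b ≤ Real.exp a * (a - b) := by
        rw [h1]; nlinarith [Real.exp_pos a]
    _ ≤ _ := mul_le_mul_of_nonneg_right h3 (sub_nonneg.2 h)

/-- Young's inequality for the entropy function. -/
theorem mul_le_mul_log_sub_add_exp {a : ℝ} (ha : 0 ≤ a) (b : ℝ) :
    a * b ≤ a * Real.log a - a + Real.exp b := by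
  rcases ha.eq_or_lt with rfl | ha
  · simpa using (Real.exp_pos b).le
  have h := Real.add_one_le_exp (b - Real.log a)
  rw [Real.exp_sub, Real.exp_log ha, le_div_iff₀ ha] at h
  linarith

/-- The right difference quotients are dominated by the constant `L`. Only right derivatives are
treated because along a càdlàg path a time integral is differentiable from the right, with the
expected value, but not necessarily from the left. -/
theorem hasDerivWithinAt_integral_of_lipschitz_right {α : Type*} [MeasurableSpace α]
    {μ : Measure α} [IsFiniteMeasure μ] {G : ℝ → α → ℝ} {G' : α → ℝ} {t b C L : ℝ} (htb : t < b)
    (hm : ∀ s ∈ Set.Ico t b, AEStronglyMeasurable (G s) μ)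
    (hC : ∀ s ∈ Set.Ico t b, ∀ a, |G s a| ≤ C)
    (hL : ∀ s ∈ Set.Ico t b, ∀ a, |G s a - G t a| ≤ L * (s - t))
    (hd : ∀ a, HasDerivWithinAt (fun s => G s a) (G' a) (Set.Ici t) t) :
    HasDerivWithinAt (fun s => ∫ a, G s a ∂μ) (∫ a, G' a ∂μ) (Set.Ici t) t := by
  have hev : ∀ᶠ s in 𝓝[>] t, s ∈ Set.Ioo t b := Ioo_mem_nhdsGT htb
  have hi : ∀ s ∈ Set.Ico t b, Integrable (G s) μ := fun s hs =>
    Integrable.of_bound (hm s hs) C (Eventually.of_forall (hC s hs))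
  have ht : t ∈ Set.Ico t b := ⟨le_rfl, htb⟩
  rw [← hasDerivWithinAt_Ioi_iff_Ici, hasDerivWithinAt_iff_tendsto_slope' (by simp)]
  have key : Tendsto (fun s => ∫ a, slope (fun s => G s a) t s ∂μ) (𝓝[>] t)
      (𝓝 (∫ a, G' a ∂μ)) := by
    refine tendsto_integral_filter_of_dominated_convergence (fun _ => L) ?_ ?_
      (integrable_const L) ?_
    · filter_upwards [hev] with s hs
      simp only [slope_def_field, div_eq_inv_mul]
      exact AEStronglyMeasurable.const_mul ((hm s ⟨hs.1.le, hs.2⟩).sub (hm t ht)) _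
    · filter_upwards [hev] with s hs
      refine Eventually.of_forall fun a => ?_
      have hst : 0 < s - t := sub_pos.2 hs.1
      rw [slope_def_field, Real.norm_eq_abs, abs_div, abs_of_pos hst, div_le_iff₀ hst]
      exact hL s ⟨hs.1.le, hs.2⟩ a
    · refine Eventually.of_forall fun a => ?_
      exact (hasDerivWithinAt_iff_tendsto_slope' (by simp)).1
        (hasDerivWithinAt_Ioi_iff_Ici.2 (hd a))
  refine key.congr' ?_
  filter_upwards [hev] with s hs
  simp only [slope_def_field]
  rw [integral_div, integral_sub (hi s ⟨hs.1.le, hs.2⟩) (hi t ht)]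

theorem tendsto_eLpNorm_two_of_bounded {α ι : Type*} [MeasurableSpace α] {μ : Measure α}
    [IsFiniteMeasure μ] {l : Filter ι} [l.IsCountablyGenerated] {F : ι → α → ℝ} {C : ℝ}
    (hm : ∀ᶠ i in l, AEStronglyMeasurable (F i) μ) (hC : ∀ᶠ i in l, ∀ a, |F i a| ≤ C)
    (hF : ∀ a, Tendsto (fun i => F i a) l (𝓝 0)) :
    Tendsto (fun i => eLpNorm (F i) 2 μ) l (𝓝 0) := by
  have h1 : Tendsto (fun i => ∫⁻ a, ‖F i a‖ₑ ^ (2 : ℝ) ∂μ) l (𝓝 (∫⁻ _, 0 ∂μ)) := by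
    refine tendsto_lintegral_filter_of_dominated_convergence'
      (fun _ => ENNReal.ofReal C ^ (2 : ℝ)) ?_ ?_ ?_ ?_
    · filter_upwards [hm] with i hi using hi.enorm.pow_const _
    · filter_upwards [hC] with i hi
      refine Eventually.of_forall fun a => ?_
      gcongr
      rw [← ofReal_norm]
      exact ENNReal.ofReal_le_ofReal (hi a)
    · simp only [lintegral_const]
      exact ENNReal.mul_ne_top (by simp) (measure_ne_top _ _)
    · refine Eventually.of_forall fun a => ?_
      have := (((hF a).enorm).ennrpow_const 2)
      simpa using this
  simp only [lintegral_zero] at h1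
  have h2 := h1.ennrpow_const (1 / 2)
  simp only [one_div, inv_pos, Nat.ofNat_pos, ENNReal.zero_rpow_of_pos] at h2
  refine h2.congr fun i => ?_
  rw [eLpNorm_eq_lintegral_rpow_enorm_toReal (by simp) (by simp)]
  simp

/-! ### Path integrals: measurability, bounds and right derivatives. -/

/-- The integral of a function along the path of a process. -/
noncomputable def pathIntegral {S Ω : Type*} (X : ℝ≥0 → Ω → S) (V : S → ℝ) (s t : ℝ) (ω : Ω) : ℝ :=
  ∫ r in s..t, V (X r.toNNReal ω)

section PathIntegral

variable {S Ω : Type*} [TopologicalSpace S] [PolishSpace S] [MeasurableSpace S] [BorelSpace S]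
  [mΩ : MeasurableSpace Ω] {X : ℝ≥0 → Ω → S} {V : S → ℝ} {M : ℝ}

theorem IsCadlag.continuousWithinAt (hX : IsCadlag X) (ω : Ω) (t : ℝ≥0) :
    ContinuousWithinAt (fun s => X s ω) (Set.Ici t) t :=
  continuousWithinAt_Ioi_iff_Ici.1 (hX ω t).1

/-- Kept general in the process and the σ-algebra so that it also applies to the process stopped at
`T` with `ℱ T`, where it yields progressive measurability. -/
theorem measurable_uncurry_toNNReal_of_rightContinuous {Y : ℝ≥0 → Ω → S}
    (hm : ∀ t, Measurable (Y t))
    (hc : ∀ ω t, ContinuousWithinAt (fun s => Y s ω) (Set.Ici t) t) :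
    Measurable fun q : ℝ × Ω => Y q.1.toNNReal q.2 :=
  let := TopologicalSpace.upgradeIsCompletelyMetrizable S
  (measurable_uncurry_of_rightContinuous hm hc).comp
    ((measurable_real_toNNReal.comp measurable_fst).prodMk measurable_snd)

theorem IsCadlag.measurable_uncurry (hX : IsCadlag X) (hm : ∀ t, Measurable (X t)) :
    Measurable fun q : ℝ × Ω => X q.1.toNNReal q.2 :=
  measurable_uncurry_toNNReal_of_rightContinuous hm hX.continuousWithinAt

theorem measurable_pathIntegral_of_uncurry
    (hX : Measurable fun q : ℝ × Ω => X q.1.toNNReal q.2) (hV : Measurable V) (s t : ℝ) :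
    Measurable (pathIntegral X V s t) := by
  have h : StronglyMeasurable fun q : Ω × ℝ => V (X q.2.toNNReal q.1) :=
    (hV.comp (hX.comp measurable_swap)).stronglyMeasurable
  unfold pathIntegral intervalIntegral
  exact (h.integral_prod_right.sub h.integral_prod_right).measurable

theorem measurable_pathIntegral (hX : IsCadlag X) (hm : ∀ t, Measurable (X t)) (hV : Measurable V)
    (s t : ℝ) : Measurable (pathIntegral X V s t) :=
  measurable_pathIntegral_of_uncurry (hX.measurable_uncurry hm) hV s t

theorem measurable_comp_path (hX : IsCadlag X) (hm : ∀ t, Measurable (X t)) (hV : Measurable V)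
    (ω : Ω) : Measurable fun r : ℝ => V (X r.toNNReal ω) :=
  hV.comp ((hX.measurable_uncurry hm).comp (measurable_id.prodMk measurable_const))

theorem intervalIntegrable_comp_path (hX : IsCadlag X) (hm : ∀ t, Measurable (X t))
    (hV : Measurable V) (hM : ∀ x, |V x| ≤ M) (ω : Ω) (s t : ℝ) :
    IntervalIntegrable (fun r : ℝ => V (X r.toNNReal ω)) volume s t :=
  (intervalIntegrable_const (c := M)).mono_fun
    (measurable_comp_path hX hm hV ω).aestronglyMeasurable
    (Eventually.of_forall fun _ => (hM _).trans (le_abs_self M))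

theorem pathIntegral_sub (hX : IsCadlag X) (hm : ∀ t, Measurable (X t))
    (hV : Measurable V) (hM : ∀ x, |V x| ≤ M) (ω : Ω) (r s t : ℝ) :
    pathIntegral X V r t ω - pathIntegral X V r s ω = pathIntegral X V s t ω :=
  intervalIntegral.integral_interval_sub_left (intervalIntegrable_comp_path hX hm hV hM ω r t)
    (intervalIntegrable_comp_path hX hm hV hM ω r s)

theorem abs_pathIntegral_le (hM : ∀ x, |V x| ≤ M) (ω : Ω) (s t : ℝ) :
    |pathIntegral X V s t ω| ≤ M * |t - s| := by
  rw [← Real.norm_eq_abs]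
  exact intervalIntegral.norm_integral_le_of_norm_le_const fun _ _ => hM _

theorem continuousWithinAt_comp_path (hX : IsCadlag X) (hV : Continuous V) (ω : Ω) (t : ℝ) :
    ContinuousWithinAt (fun r : ℝ => V (X r.toNNReal ω)) (Set.Ici t) t :=
  hV.continuousAt.comp_continuousWithinAt ((hX.continuousWithinAt ω t.toNNReal).comp
    continuous_real_toNNReal.continuousWithinAt fun _ hr => Real.toNNReal_le_toNNReal hr)

theorem hasDerivWithinAt_pathIntegral (hX : IsCadlag X) (hm : ∀ t, Measurable (X t))
    [OpensMeasurableSpace S]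
    (hV : Continuous V) (hM : ∀ x, |V x| ≤ M) (ω : Ω) (s t : ℝ) :
    HasDerivWithinAt (fun r => pathIntegral X V s r ω) (V (X t.toNNReal ω)) (Set.Ici t) t :=
  intervalIntegral.integral_hasDerivWithinAt_right
    (intervalIntegrable_comp_path hX hm hV.measurable hM ω s t)
    ((measurable_comp_path hX hm hV.measurable ω).stronglyMeasurable.stronglyMeasurableAtFilter)
    ((continuousWithinAt_comp_path hX hV ω t).mono Set.Ioi_subset_Ici_self)

end PathIntegral

/-! ### The Feynman-Kac functional and its Markov property. -/

section FeynmanKac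

variable {S Ω : Type*} [TopologicalSpace S] [PolishSpace S] [MeasurableSpace S] [BorelSpace S]
  [mΩ : MeasurableSpace Ω] {ℱ : Filtration ℝ≥0 mΩ} {X : ℝ≥0 → Ω → S} {p : ℝ≥0 → S → Measure S}
  {P : PathFamily X} {V : S → ℝ} {M : ℝ}

theorem PathFamily.aestronglyMeasurable_integral (P : PathFamily X) {Y : Ω → ℝ}
    (hY : Measurable Y) (hi : ∀ x, Integrable Y (P.law x)) (ν : Measure S)
    [hν : IsProbabilityMeasure ν] :
    AEStronglyMeasurable (fun x => ∫ ω, Y ω ∂P.law x) ν := by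
  simp only [integral_eq_lintegral_pos_part_sub_lintegral_neg_part (hi _)]
  exact ((P.universallyMeasurable_lintegral hY.ennreal_ofReal ν hν).ennreal_toReal.sub
    (P.universallyMeasurable_lintegral hY.neg.ennreal_ofReal ν hν).ennreal_toReal
    ).aestronglyMeasurable

/-- The Feynman-Kac functional `E^x[exp ∫₀ᵗ V(X_s) ds]`. -/
noncomputable def feynmanKac {S Ω : Type*} [MeasurableSpace S] [MeasurableSpace Ω]
    {X : ℝ≥0 → Ω → S} (P : PathFamily X) (V : S → ℝ) (t : ℝ) (x : S) : ℝ :=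
  ∫ ω, Real.exp (pathIntegral X V 0 t ω) ∂P.law x

/-- Since `V` is continuous and paths are right-continuous, the exponential is a bounded limit of
products over time grids, and for such products the Markov property at time `s` is
`IsMarkovFamily.lintegral_mul_prod`. -/
theorem IsMarkovFamily.lintegral_exp_pathIntegral (hP : IsMarkovFamily ℱ X p P)
    (hV : Continuous V) (hM : ∀ x, |V x| ≤ M) (x : S) (s t : ℝ≥0) :
    ∫⁻ ω, ENNReal.ofReal (Real.exp (pathIntegral X V s (s + t) ω)) ∂P.law x =
      ∫⁻ y, ∫⁻ ω, ENNReal.ofReal (Real.exp (pathIntegral X V 0 t ω)) ∂P.law y ∂p s x := by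
  have := P.isProb
  have := hP.transProb s
  set F : ℕ → ℝ≥0 → Ω → ℝ≥0∞ := fun n s ω => ∏ i ∈ Finset.range (n + 1),
    ENNReal.ofReal (Real.exp ((t / ((n : ℝ) + 1)) *
      V (X (s + ((i : ℝ≥0) + 1) * (t / ((n : ℝ≥0) + 1))) ω))) with hF
  have hφ : ∀ n : ℕ, Measurable fun y : S =>
      ENNReal.ofReal (Real.exp ((t / ((n : ℝ) + 1)) * V y)) := fun n =>
    (Real.measurable_exp.comp (hV.measurable.const_mul _)).ennreal_ofReal
  have hFm : ∀ n s, Measurable (F n s) := fun n s =>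
    Finset.measurable_prod _ fun i _ => (hφ n).comp (hP.measurable _)
  have hFe : ∀ n s ω, F n s ω = ENNReal.ofReal (Real.exp (∑ i ∈ Finset.range (n + 1),
      (t / ((n : ℝ) + 1)) * V (X (s + ((i : ℝ≥0) + 1) * (t / ((n : ℝ≥0) + 1))) ω))) := by
    intro n s ω
    rw [Real.exp_sum, ENNReal.ofReal_prod_of_nonneg fun i _ => (Real.exp_pos _).le]
  have hFb : ∀ n s ω, F n s ω ≤ ENNReal.ofReal (Real.exp (t * M)) := by
    intro n s ω
    rw [hFe]
    refine ENNReal.ofReal_le_ofReal (Real.exp_le_exp.2 ?_)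
    have hn : (0 : ℝ) < (n : ℝ) + 1 := by positivity
    refine (Finset.sum_le_sum (g := fun _ => t / ((n : ℝ) + 1) * M) fun i _ =>
      mul_le_mul_of_nonneg_left ((le_abs_self _).trans (hM _)) (by positivity)).trans ?_
    rw [Finset.sum_const, Finset.card_range, nsmul_eq_mul]
    push_cast
    rw [← mul_assoc, mul_div_cancel₀ _ hn.ne']
  have hFt : ∀ s ω, Tendsto (fun n => F n s ω) atTop
      (𝓝 (ENNReal.ofReal (Real.exp (pathIntegral X V s (s + t) ω)))) := by
    intro s ω
    simp only [hFe]
    refine (ENNReal.continuous_ofReal.comp Real.continuous_exp).continuousAt.tendsto.comp ?_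
    have := tendsto_riemannSum_right (s := s)
      (measurable_comp_path hP.cadlag hP.measurable hV.measurable ω)
      (fun r => hM _) (fun r _ => continuousWithinAt_comp_path hP.cadlag hV ω r) t.coe_nonneg
    refine this.congr fun n => Finset.sum_congr rfl fun i _ => ?_
    congr 3
    apply NNReal.coe_injective
    rw [Real.coe_toNNReal _ (by positivity)]
    push_cast
    rfl
  have hlim : ∀ s x, Tendsto (fun n => ∫⁻ ω, F n s ω ∂P.law x) atTop
      (𝓝 (∫⁻ ω, ENNReal.ofReal (Real.exp (pathIntegral X V s (s + t) ω)) ∂P.law x)) := fun s x =>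
    tendsto_lintegral_of_dominated_convergence (fun _ => ENNReal.ofReal (Real.exp (t * M)))
      (fun n => hFm n s) (fun n => Eventually.of_forall (hFb n s)) (by simp)
      (Eventually.of_forall (hFt s))
  have hlim2 : Tendsto (fun n => ∫⁻ y, ∫⁻ ω, F n 0 ω ∂P.law y ∂p s x) atTop
      (𝓝 (∫⁻ y, ∫⁻ ω, ENNReal.ofReal (Real.exp (pathIntegral X V 0 t ω)) ∂P.law y ∂p s x)) := by
    refine tendsto_lintegral_of_dominated_convergence' (fun _ => ENNReal.ofReal (Real.exp (t * M)))
      (fun n => P.universallyMeasurable_lintegral (hFm n 0) _ (this x))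
      (fun n => Eventually.of_forall fun y => ?_) (by simp) (Eventually.of_forall fun y => ?_)
    · exact (lintegral_mono (hFb n 0)).trans (by simp)
    · simpa using hlim 0 y
  refine tendsto_nhds_unique (hlim s x) (hlim2.congr fun n => ?_)
  have h := hP.lintegral_mul_prod (hφ n) (t / ((n : ℝ≥0) + 1)) (n + 1) x s
    (Z := fun _ => 1) (@measurable_const _ _ _ (ℱ s) _)
  simp only [one_mul] at h
  refine Eq.trans ?_ h.symm
  rw [← hP.map_law x s, lintegral_map' _ (hP.measurable s).aemeasurable]
  · simp only [hF, zero_add]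
  · rw [hP.map_law x s]
    exact P.universallyMeasurable_lintegral (hFm n 0) _ (this x)

theorem integrable_exp_pathIntegral (hX : IsCadlag X) (hm : ∀ t, Measurable (X t))
    (hV : Measurable V) (hM : ∀ x, |V x| ≤ M) (s t : ℝ) (ν : Measure Ω) [IsFiniteMeasure ν] :
    Integrable (fun ω => Real.exp (pathIntegral X V s t ω)) ν :=
  Integrable.of_bound (measurable_pathIntegral hX hm hV s t).exp.aestronglyMeasurable
    (Real.exp (M * |t - s|)) (Eventually.of_forall fun ω => by
      rw [Real.norm_eq_abs, Real.abs_exp]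
      exact Real.exp_le_exp.2 ((le_abs_self _).trans (abs_pathIntegral_le hM ω s t)))

theorem ofReal_feynmanKac (hX : IsCadlag X) (hm : ∀ t, Measurable (X t))
    (hV : Measurable V) (hM : ∀ x, |V x| ≤ M) (t : ℝ) (x : S) :
    ENNReal.ofReal (feynmanKac P V t x) =
      ∫⁻ ω, ENNReal.ofReal (Real.exp (pathIntegral X V 0 t ω)) ∂P.law x := by
  have := P.isProb x
  exact ofReal_integral_eq_lintegral_ofReal (integrable_exp_pathIntegral hX hm hV hM 0 t _)
    (Eventually.of_forall fun ω => (Real.exp_pos _).le)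

theorem aestronglyMeasurable_feynmanKac (hX : IsCadlag X) (hm : ∀ t, Measurable (X t))
    (hV : Measurable V) (hM : ∀ x, |V x| ≤ M) (t : ℝ) (ν : Measure S) [IsProbabilityMeasure ν] :
    AEStronglyMeasurable (feynmanKac P V t) ν :=
  have := P.isProb
  P.aestronglyMeasurable_integral (measurable_pathIntegral hX hm hV 0 t).exp
    (fun _ => integrable_exp_pathIntegral hX hm hV hM 0 t _) ν

theorem feynmanKac_nonneg (t : ℝ) (x : S) : 0 ≤ feynmanKac P V t x :=
  integral_nonneg fun _ => (Real.exp_pos _).le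

/-- The semigroup acting on the functional becomes an expectation under one fixed law, with `s` only
in the integrand, where it can be differentiated. -/
theorem IsMarkovFamily.integral_feynmanKac (hP : IsMarkovFamily ℱ X p P)
    (hV : Continuous V) (hM : ∀ x, |V x| ≤ M) (x : S) (s t : ℝ≥0) :
    ∫ y, feynmanKac P V t y ∂p s x =
      ∫ ω, Real.exp (pathIntegral X V s (s + t) ω) ∂P.law x := by
  have := P.isProb x
  have := hP.transProb s x
  rw [integral_eq_lintegral_of_nonneg_ae (Eventually.of_forall fun y => feynmanKac_nonneg _ y)
      (aestronglyMeasurable_feynmanKac hP.cadlag hP.measurable hV.measurable hM _ _),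
    integral_eq_lintegral_of_nonneg_ae (Eventually.of_forall fun ω => (Real.exp_pos _).le)
      (measurable_pathIntegral hP.cadlag hP.measurable hV.measurable _ _).exp.aestronglyMeasurable,
    hP.lintegral_exp_pathIntegral hV hM x s t]
  simp only [ofReal_feynmanKac hP.cadlag hP.measurable hV.measurable hM]

end FeynmanKac

/-! ### Feynman-Kac functionals in the domain of the generator, and the energy estimate. -/

section FeynmanKacBound

variable {S Ω : Type*} [TopologicalSpace S] [PolishSpace S] [MeasurableSpace S] [BorelSpace S]
  [mΩ : MeasurableSpace Ω] {ℱ : Filtration ℝ≥0 mΩ} {X : ℝ≥0 → Ω → S} {p : ℝ≥0 → S → Measure S}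
  {P : PathFamily X} {V : S → ℝ} {M : ℝ}

/-- The right derivative in time of the Feynman-Kac functional. -/
noncomputable def feynmanKacDeriv {S Ω : Type*} [MeasurableSpace S] [MeasurableSpace Ω]
    {X : ℝ≥0 → Ω → S} (P : PathFamily X) (V : S → ℝ) (t : ℝ) (x : S) : ℝ :=
  ∫ ω, Real.exp (pathIntegral X V 0 t ω) * V (X t.toNNReal ω) ∂P.law x

theorem abs_pathIntegral_le_of_le (hM : ∀ x, |V x| ≤ M) (hM0 : 0 ≤ M) (ω : Ω) {t b : ℝ}
    (ht : 0 ≤ t) (htb : t ≤ b) : |pathIntegral X V 0 t ω| ≤ M * b :=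
  (abs_pathIntegral_le hM ω 0 t).trans
    (mul_le_mul_of_nonneg_left (by rwa [sub_zero, abs_of_nonneg ht]) hM0)

theorem abs_exp_pathIntegral_sub_le (hX : IsCadlag X) (hm : ∀ t, Measurable (X t))
    (hV : Measurable V) (hM : ∀ x, |V x| ≤ M) (hM0 : 0 ≤ M) (ω : Ω) {s t b : ℝ}
    (hs : 0 ≤ s) (hsb : s ≤ b) (ht : 0 ≤ t) (htb : t ≤ b) :
    |Real.exp (pathIntegral X V 0 s ω) - Real.exp (pathIntegral X V 0 t ω)| ≤
      Real.exp (M * b) * M * |s - t| := by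
  refine (abs_exp_sub_exp_le (abs_pathIntegral_le_of_le hM hM0 ω hs hsb)
    (abs_pathIntegral_le_of_le hM hM0 ω ht htb)).trans ?_
  rw [pathIntegral_sub hX hm hV hM, mul_assoc]
  gcongr
  exact abs_pathIntegral_le hM ω t s

theorem feynmanKac_le (hM : ∀ x, |V x| ≤ M) {t : ℝ} (ht : 0 ≤ t) (x : S) :
    feynmanKac P V t x ≤ Real.exp (M * t) := by
  have := P.isProb x
  have h := norm_integral_le_of_norm_le_const (μ := P.law x)
    (f := fun ω => Real.exp (pathIntegral X V 0 t ω)) (C := Real.exp (M * t))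
    (Eventually.of_forall fun ω => by
      rw [Real.norm_eq_abs, Real.abs_exp]
      refine Real.exp_le_exp.2 ((le_abs_self _).trans ((abs_pathIntegral_le hM ω 0 t).trans ?_))
      rw [sub_zero, abs_of_nonneg ht])
  simp only [probReal_univ, mul_one] at h
  exact (le_abs_self _).trans h

theorem feynmanKac_pos (hX : IsCadlag X) (hm : ∀ t, Measurable (X t)) (hV : Measurable V)
    (hM : ∀ x, |V x| ≤ M) (t : ℝ) (x : S) : 0 < feynmanKac P V t x :=
  have := P.isProb x
  integral_exp_pos (integrable_exp_pathIntegral hX hm hV hM 0 t _)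

theorem abs_feynmanKac_sub_le (hX : IsCadlag X) (hm : ∀ t, Measurable (X t))
    (hV : Measurable V) (hM : ∀ x, |V x| ≤ M) (hM0 : 0 ≤ M) (x : S) {s t b : ℝ}
    (hs : 0 ≤ s) (hsb : s ≤ b) (ht : 0 ≤ t) (htb : t ≤ b) :
    |feynmanKac P V s x - feynmanKac P V t x| ≤ Real.exp (M * b) * M * |s - t| := by
  have := P.isProb x
  unfold feynmanKac
  rw [← integral_sub (integrable_exp_pathIntegral hX hm hV hM 0 s _)
    (integrable_exp_pathIntegral hX hm hV hM 0 t _)]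
  have h := norm_integral_le_of_norm_le_const (μ := P.law x)
    (f := fun ω => Real.exp (pathIntegral X V 0 s ω) - Real.exp (pathIntegral X V 0 t ω))
    (Eventually.of_forall fun ω =>
      abs_exp_pathIntegral_sub_le hX hm hV hM hM0 ω hs hsb ht htb)
  simpa using h

theorem measurable_exp_pathIntegral_mul (hX : IsCadlag X) (hm : ∀ t, Measurable (X t))
    (hV : Measurable V) (t : ℝ) :
    Measurable fun ω => Real.exp (pathIntegral X V 0 t ω) * V (X t.toNNReal ω) :=
  (measurable_pathIntegral hX hm hV 0 t).exp.mul (hV.comp (hm _))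

theorem abs_exp_pathIntegral_mul_le (hM : ∀ x, |V x| ≤ M) {t : ℝ} (ht : 0 ≤ t) (ω : Ω) :
    |Real.exp (pathIntegral X V 0 t ω) * V (X t.toNNReal ω)| ≤ Real.exp (M * t) * M := by
  rw [abs_mul, Real.abs_exp]
  refine mul_le_mul (Real.exp_le_exp.2 ((le_abs_self _).trans
    ((abs_pathIntegral_le hM ω 0 t).trans ?_))) (hM _) (abs_nonneg _) (Real.exp_pos _).le
  rw [sub_zero, abs_of_nonneg ht]

theorem abs_feynmanKacDeriv_le (hM : ∀ x, |V x| ≤ M) {t : ℝ} (ht : 0 ≤ t) (x : S) :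
    |feynmanKacDeriv P V t x| ≤ Real.exp (M * t) * M := by
  have := P.isProb x
  have h := norm_integral_le_of_norm_le_const (μ := P.law x)
    (f := fun ω => Real.exp (pathIntegral X V 0 t ω) * V (X t.toNNReal ω))
    (Eventually.of_forall fun ω => abs_exp_pathIntegral_mul_le hM ht ω)
  simpa [feynmanKacDeriv] using h

theorem integrable_exp_pathIntegral_mul (hX : IsCadlag X) (hm : ∀ t, Measurable (X t))
    (hV : Measurable V) (hM : ∀ x, |V x| ≤ M) {t : ℝ} (ht : 0 ≤ t) (ν : Measure Ω)
    [IsFiniteMeasure ν] :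
    Integrable (fun ω => Real.exp (pathIntegral X V 0 t ω) * V (X t.toNNReal ω)) ν :=
  Integrable.of_bound (measurable_exp_pathIntegral_mul hX hm hV t).aestronglyMeasurable _
    (Eventually.of_forall fun ω => abs_exp_pathIntegral_mul_le hM ht ω)

theorem aestronglyMeasurable_feynmanKacDeriv (hX : IsCadlag X) (hm : ∀ t, Measurable (X t))
    (hV : Measurable V) (hM : ∀ x, |V x| ≤ M) {t : ℝ} (ht : 0 ≤ t) (ν : Measure S)
    [IsProbabilityMeasure ν] : AEStronglyMeasurable (feynmanKacDeriv P V t) ν :=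
  have := P.isProb
  P.aestronglyMeasurable_integral (measurable_exp_pathIntegral_mul hX hm hV t)
    (fun _ => integrable_exp_pathIntegral_mul hX hm hV hM ht _) ν

theorem hasDerivWithinAt_feynmanKac (hX : IsCadlag X) (hm : ∀ t, Measurable (X t))
    (hV : Continuous V) (hM : ∀ x, |V x| ≤ M) (hM0 : 0 ≤ M) {t : ℝ} (ht : 0 ≤ t) (x : S) :
    HasDerivWithinAt (fun s => feynmanKac P V s x) (feynmanKacDeriv P V t x) (Set.Ici t) t := by
  have := P.isProb x
  refine hasDerivWithinAt_integral_of_lipschitz_right (b := t + 1) (C := Real.exp (M * (t + 1)))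
    (L := Real.exp (M * (t + 1)) * M) (by linarith)
    (fun s _ => (measurable_pathIntegral hX hm hV.measurable 0 s).exp.aestronglyMeasurable)
    (fun s hs ω => ?_) (fun s hs ω => ?_) fun ω => ?_
  · rw [Real.abs_exp]
    exact Real.exp_le_exp.2 ((le_abs_self _).trans
      (abs_pathIntegral_le_of_le hM hM0 ω (ht.trans hs.1) hs.2.le))
  · rw [← abs_of_nonneg (sub_nonneg.2 hs.1)]
    exact abs_exp_pathIntegral_sub_le hX hm hV.measurable hM hM0 ω (ht.trans hs.1) hs.2.le ht
      (by linarith)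
  · exact (hasDerivWithinAt_pathIntegral hX hm hV hM ω 0 t).exp

theorem abs_exp_pathIntegral_shift_sub_le (hX : IsCadlag X) (hm : ∀ t, Measurable (X t))
    (hV : Measurable V) (hM : ∀ x, |V x| ≤ M) (ω : Ω) {h t : ℝ} (hh : 0 ≤ h)
    (ht : 0 ≤ t) :
    |Real.exp (pathIntegral X V h (h + t) ω) - Real.exp (pathIntegral X V 0 t ω)| ≤
      Real.exp (M * t) * (2 * M) * h := by
  have h1 : ∀ s, |pathIntegral X V s (s + t) ω| ≤ M * t := fun s => by
    simpa [abs_of_nonneg ht] using abs_pathIntegral_le hM ω s (s + t)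
  have h2 := h1 0
  rw [zero_add] at h2
  refine (abs_exp_sub_exp_le (h1 h) h2).trans ?_
  rw [mul_assoc]
  refine mul_le_mul_of_nonneg_left ?_ (Real.exp_pos _).le
  -- Sliding the window gains `[t, h + t]` and loses `[0, h]`; each contributes at most `M * h`,
  -- hence the factor `2 * M`.
  have e : pathIntegral X V h (h + t) ω - pathIntegral X V 0 t ω =
      pathIntegral X V t (h + t) ω - pathIntegral X V 0 h ω := by
    rw [← pathIntegral_sub hX hm hV hM ω 0 h (h + t), ← pathIntegral_sub hX hm hV hM ω 0 t (h + t)]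
    ring
  have h3 := abs_pathIntegral_le (X := X) hM ω t (h + t)
  have h4 := abs_pathIntegral_le (X := X) hM ω 0 h
  rw [add_sub_cancel_right, abs_of_nonneg hh] at h3
  rw [sub_zero, abs_of_nonneg hh] at h4
  rw [e]
  refine (abs_sub _ _).trans ?_
  linarith

/-- This is the pointwise generator of the Feynman-Kac functional. Sliding the window adds `V (X_t)`
at its right end and removes `V (X_0)`, almost surely `V x`, at its left end. -/
theorem IsMarkovFamily.hasDerivWithinAt_shift (hP : IsMarkovFamily ℱ X p P)
    (hV : Continuous V) (hM : ∀ x, |V x| ≤ M) {t : ℝ} (ht : 0 ≤ t) (x : S) :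
    HasDerivWithinAt (fun h => ∫ ω, Real.exp (pathIntegral X V h (h + t) ω) ∂P.law x)
      (feynmanKacDeriv P V t x - V x * feynmanKac P V t x) (Set.Ici 0) 0 := by
  have := P.isProb x
  have hX := hP.cadlag
  have hm := hP.measurable
  have e : feynmanKacDeriv P V t x - V x * feynmanKac P V t x =
      ∫ ω, Real.exp (pathIntegral X V 0 t ω) * (V (X t.toNNReal ω) - V (X 0 ω)) ∂P.law x := by
    unfold feynmanKacDeriv feynmanKac
    rw [← integral_const_mul, ← integral_sub
      (integrable_exp_pathIntegral_mul hX hm hV.measurable hM ht _)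
      ((integrable_exp_pathIntegral hX hm hV.measurable hM 0 t _).const_mul _)]
    refine integral_congr_ae ?_
    filter_upwards [hP.ae_start x] with ω hω
    rw [hω]
    ring
  rw [e]
  refine hasDerivWithinAt_integral_of_lipschitz_right (b := 1) (C := Real.exp (M * t))
    (L := Real.exp (M * t) * (2 * M)) (by linarith)
    (fun s _ => (measurable_pathIntegral hX hm hV.measurable s (s + t)).exp.aestronglyMeasurable)
    (fun s hs ω => ?_) (fun s hs ω => ?_) fun ω => ?_
  · rw [Real.abs_exp]
    refine Real.exp_le_exp.2 ((le_abs_self _).trans ?_)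
    simpa [abs_of_nonneg ht] using abs_pathIntegral_le hM ω s (s + t)
  · rw [zero_add, sub_zero]
    exact abs_exp_pathIntegral_shift_sub_le hX hm hV.measurable hM ω hs.1 ht
  · have d1 : HasDerivWithinAt (fun h => pathIntegral X V 0 (h + t) ω) (V (X t.toNNReal ω))
        (Set.Ici 0) 0 := by
      have := HasDerivWithinAt.comp (h := fun h : ℝ => h + t) (h₂ := fun r => pathIntegral X V 0 r ω)
        (h₂' := V (X t.toNNReal ω)) (s := Set.Ici 0) (s' := Set.Ici t) 0
        (by simpa using hasDerivWithinAt_pathIntegral hX hm hV hM ω 0 t)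
        ((hasDerivWithinAt_id 0 _).add_const t) (fun h hh => by simpa using hh)
      rw [mul_one] at this
      exact this
    have d2 : HasDerivWithinAt (fun h => pathIntegral X V 0 h ω) (V (X 0 ω)) (Set.Ici 0) 0 := by
      simpa using hasDerivWithinAt_pathIntegral hX hm hV hM ω 0 0
    have d3 := (d1.sub d2).exp
    have e2 : (fun h => Real.exp (pathIntegral X V h (h + t) ω)) = fun h =>
        Real.exp (((fun h => pathIntegral X V 0 (h + t) ω) - fun h => pathIntegral X V 0 h ω) h) := by
      ext h
      rw [Pi.sub_apply, pathIntegral_sub hX hm hV.measurable hM]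
    rw [e2]
    convert d3 using 2
    simp [pathIntegral_sub hX hm hV.measurable hM]

/-- The Feynman-Kac functional lies in the domain of the generator. -/
theorem IsMarkovFamily.generatorGraph_feynmanKac (hP : IsMarkovFamily ℱ X p P)
    (hV : Continuous V) (hM : ∀ x, |V x| ≤ M) (t : ℝ≥0) (μ : Measure S)
    [IsProbabilityMeasure μ] :
    GeneratorGraph p μ (feynmanKac P V t)
      (fun x => feynmanKacDeriv P V t x - V x * feynmanKac P V t x) := by
  have := P.isProb
  have hX := hP.cadlag
  have hm := hP.measurable
  have hVm := hV.measurable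
  have hu := aestronglyMeasurable_feynmanKac (P := P) hX hm hVm hM t μ
  have hub : ∀ x, |feynmanKac P V t x| ≤ Real.exp (M * t) := fun x => by
    rw [abs_of_nonneg (feynmanKac_nonneg _ x)]
    exact feynmanKac_le hM t.2 x
  have hw := (aestronglyMeasurable_feynmanKacDeriv (P := P) hX hm hVm hM t.2 μ).sub
    (hVm.aestronglyMeasurable.mul hu)
  have hwb : ∀ x, |feynmanKacDeriv P V t x - V x * feynmanKac P V t x| ≤
      Real.exp (M * t) * M + M * Real.exp (M * t) := fun x => by
    refine (abs_sub _ _).trans (add_le_add (abs_feynmanKacDeriv_le hM t.2 x) ?_)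
    rw [abs_mul]
    exact mul_le_mul (hM x) (hub x) (abs_nonneg _) ((abs_nonneg _).trans (hM x))
  refine ⟨MemLp.of_bound hu _ (Eventually.of_forall hub),
    MemLp.of_bound hw _ (Eventually.of_forall hwb), ?_⟩
  have hpos : ∀ᶠ h : ℝ≥0 in 𝓝[>] 0, 0 < h := eventually_mem_nhdsWithin
  -- Convergence in `L²` comes from pointwise convergence and a bound on the difference quotients
  -- that is uniform in `h` and `x`.
  refine tendsto_eLpNorm_two_of_bounded
    (C := Real.exp (M * t) * (2 * M) + (Real.exp (M * t) * M + M * Real.exp (M * t))) ?_ ?_ ?_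
  · refine Eventually.of_forall fun h => ?_
    simp only [hP.integral_feynmanKac hV hM, div_eq_inv_mul]
    exact (AEStronglyMeasurable.const_mul ((P.aestronglyMeasurable_integral
      (measurable_pathIntegral hX hm hVm _ _).exp
      (fun _ => integrable_exp_pathIntegral hX hm hVm hM _ _ _) μ).sub hu) _).sub hw
  · filter_upwards [hpos] with h hh x
    refine (abs_sub _ _).trans (add_le_add ?_ (hwb x))
    have hh' : (0 : ℝ) < h := hh
    rw [hP.integral_feynmanKac hV hM, abs_div, abs_of_pos hh', div_le_iff₀ hh', feynmanKac,
      ← integral_sub (integrable_exp_pathIntegral hX hm hVm hM _ _ _)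
        (integrable_exp_pathIntegral hX hm hVm hM _ _ _)]
    have := norm_integral_le_of_norm_le_const (μ := P.law x)
      (f := fun ω => Real.exp (pathIntegral X V h (h + t) ω) - Real.exp (pathIntegral X V 0 t ω))
      (Eventually.of_forall fun ω =>
        abs_exp_pathIntegral_shift_sub_le hX hm hVm hM ω hh'.le t.2)
    simpa using this
  · intro x
    have h1 := (hasDerivWithinAt_iff_tendsto_slope' (by simp)).1
      (hasDerivWithinAt_Ioi_iff_Ici.2 (hP.hasDerivWithinAt_shift hV hM t.coe_nonneg x))
    have h2 : Tendsto (fun h : ℝ≥0 => (h : ℝ)) (𝓝[>] 0) (𝓝[>] 0) := by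
      refine tendsto_nhdsWithin_iff.2 ⟨?_, ?_⟩
      · exact (NNReal.continuous_coe.tendsto 0).mono_left nhdsWithin_le_nhds
      · filter_upwards [hpos] with h hh using hh
    have h3 := (h1.comp h2).sub_const
      (feynmanKacDeriv P V t x - V x * feynmanKac P V t x)
    rw [sub_self] at h3
    refine h3.congr fun h => ?_
    simp only [Function.comp, slope_def_field, sub_zero, zero_add]
    rw [hP.integral_feynmanKac hV hM]
    rfl

theorem GeneratorGraph.const_mul {μ : Measure S} {g h : S → ℝ} (H : GeneratorGraph p μ g h)
    (a : ℝ) : GeneratorGraph p μ (fun x => a * g x) (fun x => a * h x) := by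
  refine ⟨H.1.const_mul a, H.2.1.const_mul a, ?_⟩
  have := ENNReal.Tendsto.const_mul (a := ‖a‖ₑ) H.2.2 (Or.inr enorm_ne_top)
  rw [mul_zero] at this
  refine this.congr fun t => ?_
  rw [← eLpNorm_const_smul]
  congr 1
  ext x
  simp only [Pi.smul_apply, smul_eq_mul, integral_const_mul]
  ring

/-- The logarithmic Sobolev inequality bounds the quadratic form of `A + V`. -/
theorem LogSobolev.integral_mul_le {μ : Measure S} [IsProbabilityMeasure μ] {β : ℝ} (hβ : 0 < β)
    (hLS : LogSobolev p μ β) {g h : S → ℝ} (H : GeneratorGraph p μ g h)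
    (hg : 0 < ∫ x, g x ^ 2 ∂μ) (hV : Measurable V) (hM : ∀ x, |V x| ≤ M) :
    ∫ x, (h x + V x * g x) * g x ∂μ ≤
      1 / β * Real.log (∫ x, Real.exp (β * V x) ∂μ) * ∫ x, g x ^ 2 ∂μ := by
  set N := ∫ x, g x ^ 2 ∂μ with hN
  set a := (√N)⁻¹ with ha
  have ha2 : a ^ 2 = N⁻¹ := by rw [ha, inv_pow, Real.sq_sqrt hg.le]
  set G : S → ℝ := fun x => a * g x with hG
  have H' := H.const_mul a
  have hGG : ∫ x, G x ^ 2 ∂μ = 1 := by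
    simp only [hG, mul_pow, integral_const_mul]
    rw [ha2, ← hN, inv_mul_cancel₀ hg.ne']
  obtain ⟨hint, hle⟩ : Integrable (fun x => G x ^ 2 * Real.log (G x ^ 2)) μ ∧
      ∫ x, G x ^ 2 * Real.log (G x ^ 2) ∂μ ≤ -β * ∫ x, a * h x * G x ∂μ := hLS _ _ H' hGG
  have hexp : Integrable (fun x => Real.exp (β * V x)) μ :=
    Integrable.of_bound (hV.const_mul β).exp.aestronglyMeasurable (Real.exp (β * M))
      (Eventually.of_forall fun x => by
        rw [Real.norm_eq_abs, Real.abs_exp]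
        exact Real.exp_le_exp.2 (mul_le_mul_of_nonneg_left ((le_abs_self _).trans (hM x)) hβ.le))
  set Z := ∫ x, Real.exp (β * V x) ∂μ with hZ
  have hZpos : 0 < Z := integral_exp_pos hexp
  have iG : Integrable (fun x => G x ^ 2) μ := H'.1.integrable_sq
  have iVG : Integrable (fun x => V x * G x ^ 2) μ :=
    iG.bdd_mul hV.aestronglyMeasurable (Eventually.of_forall hM)
  have ihG : Integrable (fun x => a * h x * G x) μ := H'.2.1.integrable_mul H'.1
  -- Young's inequality at `a = G²`, `b = β V - log Z`. The shift normalises `exp(β V) / Z` to total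
  -- mass one, which cancels `-∫ G² = -1`.
  have key : ∫ x, β * (V x * G x ^ 2) - Real.log Z * G x ^ 2 ∂μ ≤
      ∫ x, G x ^ 2 * Real.log (G x ^ 2) - G x ^ 2 + Z⁻¹ * Real.exp (β * V x) ∂μ := by
    refine integral_mono ((iVG.const_mul β).sub (iG.const_mul _))
      ((hint.sub iG).add (hexp.const_mul _)) fun x => ?_
    have := mul_le_mul_log_sub_add_exp (sq_nonneg (G x)) (β * V x - Real.log Z)
    rw [Real.exp_sub, Real.exp_log hZpos, div_eq_inv_mul] at this
    simp only
    linarith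
  rw [integral_sub (iVG.const_mul β) (iG.const_mul _), integral_add (f := fun x =>
      G x ^ 2 * Real.log (G x ^ 2) - G x ^ 2) (hint.sub iG) (hexp.const_mul _),
    integral_sub hint iG, integral_const_mul, integral_const_mul,
    integral_const_mul, hGG, ← hZ, inv_mul_cancel₀ hZpos.ne'] at key
  have hfin : β * (∫ x, a * h x * G x ∂μ + ∫ x, V x * G x ^ 2 ∂μ) ≤ Real.log Z := by
    linarith
  rw [← integral_add ihG iVG] at hfin
  have e : ∀ x, a * h x * G x + V x * G x ^ 2 = N⁻¹ * ((h x + V x * g x) * g x) := fun x => by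
    rw [← ha2, hG]
    ring
  simp only [e, integral_const_mul] at hfin
  rw [mul_comm _ N, ← div_le_iff₀' hg, one_div, ← div_eq_inv_mul, le_div_iff₀' hβ, div_eq_inv_mul]
  exact hfin

/-- An energy estimate: the squared `L²(μ)` norm `φ` of the Feynman-Kac functional satisfies `φ' ≤ 2
κ φ` and `φ 0 = 1`, and its square root dominates the integral against `μ`. -/
theorem IsMarkovFamily.lintegral_init_exp_le_of_continuous (hP : IsMarkovFamily ℱ X p P)
    {μ : Measure S} [IsProbabilityMeasure μ] {β : ℝ} (hβ : 0 < β) (hLS : LogSobolev p μ β)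
    (hV : Continuous V) (hM : ∀ x, |V x| ≤ M) (T : ℝ≥0) :
    ∫⁻ ω, ENNReal.ofReal (Real.exp (pathIntegral X V 0 T ω)) ∂P.init μ ≤
      ENNReal.ofReal (Real.exp (T * (1 / β * Real.log (∫ x, Real.exp (β * V x) ∂μ)))) := by
  have hX := hP.cadlag
  have hm := hP.measurable
  have hVm := hV.measurable
  obtain ⟨x₀⟩ : Nonempty S := nonempty_of_isProbabilityMeasure μ
  have hM0 : 0 ≤ M := (abs_nonneg _).trans (hM x₀)
  set κ := 1 / β * Real.log (∫ x, Real.exp (β * V x) ∂μ) with hκ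
  set u : ℝ → S → ℝ := feynmanKac P V with hu
  have hum : ∀ t, AEStronglyMeasurable (u t) μ := fun t =>
    aestronglyMeasurable_feynmanKac hX hm hVm hM t μ
  have hub : ∀ t, 0 ≤ t → ∀ b, t ≤ b → ∀ x, |u t x| ≤ Real.exp (M * b) := fun t ht b hb x => by
    rw [abs_of_nonneg (feynmanKac_nonneg _ x)]
    exact (feynmanKac_le hM ht x).trans
      (Real.exp_le_exp.2 (mul_le_mul_of_nonneg_left hb hM0))
  have hsq : ∀ s, 0 ≤ s → ∀ t, 0 ≤ t → ∀ b, s ≤ b → t ≤ b → ∀ x,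
      |u s x ^ 2 - u t x ^ 2| ≤ (2 * Real.exp (M * b) * (Real.exp (M * b) * M)) * |s - t| := by
    intro s hs t ht b hsb htb x
    rw [sq_sub_sq, abs_mul, mul_assoc (2 * _)]
    refine mul_le_mul ((abs_add_le _ _).trans ?_)
      (abs_feynmanKac_sub_le hX hm hVm hM hM0 x hs hsb ht htb) (abs_nonneg _) (by positivity)
    linarith [hub s hs b hsb x, hub t ht b htb x]
  have hi : ∀ t, 0 ≤ t → MemLp (u t) 2 μ := fun t ht =>
    MemLp.of_bound (hum t) _ (Eventually.of_forall (hub t ht t le_rfl))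
  set φ : ℝ → ℝ := fun t => ∫ x, u t x ^ 2 ∂μ with hφ
  have hφpos : ∀ t, 0 ≤ t → 0 < φ t := fun t ht => by
    rw [hφ]
    simp only
    rw [integral_pos_iff_support_of_nonneg (fun x => sq_nonneg _) (hi t ht).integrable_sq]
    have : Function.support (fun x => u t x ^ 2) = Set.univ := by
      ext x
      simp [(feynmanKac_pos hX hm hVm hM t x).ne', hu]
    rw [this]
    simp
  have hd : ∀ t, 0 ≤ t → HasDerivWithinAt φ (∫ x, 2 * u t x * feynmanKacDeriv P V t x ∂μ)
      (Set.Ici t) t := by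
    intro t ht
    refine hasDerivWithinAt_integral_of_lipschitz_right (b := t + 1)
      (C := Real.exp (M * (t + 1)) ^ 2)
      (L := 2 * Real.exp (M * (t + 1)) * (Real.exp (M * (t + 1)) * M)) (by linarith)
      (fun s _ => (hum s).pow 2) (fun s hs x => ?_) (fun s hs x => ?_) fun x => ?_
    · rw [abs_pow]
      gcongr
      exact hub s (ht.trans hs.1) _ hs.2.le x
    · have := hsq s (ht.trans hs.1) t ht (t + 1) hs.2.le (by linarith) x
      rwa [abs_of_nonneg (sub_nonneg.2 hs.1)] at this
    · have := (hasDerivWithinAt_feynmanKac (P := P) hX hm hV hM hM0 ht x).pow 2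
      simp only [Nat.cast_ofNat, Nat.add_one_sub_one, pow_one] at this
      exact this
  -- Because `A u_t = ∂_t u_t - V u_t`, the operator `A + V` applied to `u_t` is its time
  -- derivative, and the quadratic form bound controls `φ'`.
  have hbound : ∀ t, 0 ≤ t → ∫ x, 2 * u t x * feynmanKacDeriv P V t x ∂μ ≤ 2 * κ * φ t := by
    intro t ht
    lift t to ℝ≥0 using ht
    have := hLS.integral_mul_le hβ (hP.generatorGraph_feynmanKac hV hM t μ) (hφpos t t.2) hVm hM
    simp only [sub_add_cancel] at this
    have e : ∀ x, 2 * u t x * feynmanKacDeriv P V t x =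
      2 * (feynmanKacDeriv P V t x * feynmanKac P V t x) := fun x => by rw [hu]; ring
    simp only [e, integral_const_mul]
    rw [mul_assoc]
    exact mul_le_mul_of_nonneg_left this zero_le_two
  have hcont : ContinuousOn φ (Set.Icc 0 (T : ℝ)) := by
    refine LipschitzOnWith.continuousOn (K := Real.toNNReal
      (2 * Real.exp (M * T) * (Real.exp (M * T) * M))) (LipschitzOnWith.of_dist_le_mul ?_)
    intro s hs t ht
    rw [Real.coe_toNNReal _ (by positivity), Real.dist_eq, Real.dist_eq, hφ]
    simp only
    rw [← integral_sub (hi s hs.1).integrable_sq (hi t ht.1).integrable_sq]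
    have := norm_integral_le_of_norm_le_const (μ := μ) (f := fun x => u s x ^ 2 - u t x ^ 2)
      (Eventually.of_forall fun x => hsq s hs.1 t ht.1 T hs.2 ht.2 x)
    simpa using this
  -- Only a right derivative of `φ` is available, so Grönwall is used in its form with continuity
  -- and lower right slopes.
  have hgron := le_gronwallBound_of_liminf_deriv_right_le (f := φ)
    (f' := fun t => ∫ x, 2 * u t x * feynmanKacDeriv P V t x ∂μ) (δ := 1) (K := 2 * κ) (ε := 0)
    (a := 0) (b := T) hcont
    (fun t ht r hr => by
      simpa [slope_def_module] using (hd t ht.1).liminf_right_slope_le hr)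
    (by simp [hφ, hu, feynmanKac, pathIntegral, P.isProb])
    (fun t ht => by rw [add_zero]; exact hbound t ht.1) T (Set.right_mem_Icc.2 T.2)
  rw [gronwallBound_ε0, sub_zero, one_mul] at hgron
  rw [P.lintegral_init μ (measurable_pathIntegral hX hm hVm 0 T).exp.ennreal_ofReal]
  simp only [← ofReal_feynmanKac hX hm hVm hM]
  rw [← ofReal_integral_eq_lintegral_ofReal ((hi T T.2).integrable one_le_two)
    (Eventually.of_forall fun x => feynmanKac_nonneg _ x)]
  refine ENNReal.ofReal_le_ofReal ?_
  have hvar : (∫ x, u T x ∂μ) ^ 2 ≤ φ T := by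
    have := variance_nonneg (u T) μ
    rw [variance_eq_sub (hi T T.2)] at this
    simpa [hφ] using this
  refine abs_le_of_sq_le_sq' (hvar.trans (hgron.trans_eq ?_)) (Real.exp_pos _).le |>.2
  rw [← Real.exp_nat_mul]
  congr 1
  push_cast
  ring

end FeynmanKacBound

/-! ### From bounded continuous observables to unbounded ones. -/

section Extension

variable {S Ω : Type*} [TopologicalSpace S] [PolishSpace S] [MeasurableSpace S] [BorelSpace S]
  [mΩ : MeasurableSpace Ω] {ℱ : Filtration ℝ≥0 mΩ} {X : ℝ≥0 → Ω → S} {p : ℝ≥0 → S → Measure S}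
  {P : PathFamily X} {V : S → ℝ} {M : ℝ}

theorem IsMarkovFamily.map_init (hP : IsMarkovFamily ℱ X p P) {μ : Measure S}
    [IsProbabilityMeasure μ] (hinv : IsInvariantMeasure p μ) (t : ℝ≥0) :
    (P.init μ).map (X t) = μ := by
  ext B hB
  rw [Measure.map_apply (hP.measurable t) hB, P.init_apply μ (hP.measurable t hB), ← hinv t B hB]
  congr 1 with x
  rw [← Measure.map_apply (hP.measurable t) hB, hP.map_law]

theorem measurable_occupation_of_uncurry
    (hX : Measurable fun q : ℝ × Ω => X q.1.toNNReal q.2) {g : S → ℝ≥0∞} (hg : Measurable g)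
    (T : ℝ≥0) : Measurable fun ω => ∫⁻ r in Set.Ioc (0 : ℝ) T, g (X r.toNNReal ω) :=
  Measurable.lintegral_prod_right' (f := fun q : Ω × ℝ => g (X q.2.toNNReal q.1))
    (hg.comp (hX.comp measurable_swap))

/-- Expected occupation integrals of the stationary process. -/
theorem IsMarkovFamily.lintegral_occupation (hP : IsMarkovFamily ℱ X p P) {μ : Measure S}
    [IsProbabilityMeasure μ] (hinv : IsInvariantMeasure p μ) {g : S → ℝ≥0∞} (hg : Measurable g)
    (T : ℝ≥0) :
    ∫⁻ ω, (∫⁻ r in Set.Ioc (0 : ℝ) T, g (X r.toNNReal ω)) ∂P.init μ = T * ∫⁻ x, g x ∂μ := by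
  have := P.isProbabilityMeasure_init μ
  have hj := (hP.cadlag.measurable_uncurry hP.measurable).comp measurable_swap
  rw [lintegral_lintegral_swap (f := fun ω (r : ℝ) => g (X r.toNNReal ω)) (hg.comp hj).aemeasurable]
  have : ∀ r : ℝ, ∫⁻ ω, g (X r.toNNReal ω) ∂P.init μ = ∫⁻ x, g x ∂μ := fun r => by
    rw [← lintegral_map hg (hP.measurable _), hP.map_init hinv]
  simp only [this, lintegral_const, Measure.restrict_apply_univ, Real.volume_Ioc, sub_zero]
  rw [mul_comm, ENNReal.ofReal_coe_nnreal]

theorem intervalIntegrable_comp_path_of_lintegral_lt_top (hX : IsCadlag X)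
    (hm : ∀ t, Measurable (X t)) (hV : Measurable V) {T : ℝ≥0} {ω : Ω}
    (h : ∫⁻ r in Set.Ioc (0 : ℝ) T, ‖V (X r.toNNReal ω)‖ₑ < ⊤) :
    IntervalIntegrable (fun r : ℝ => V (X r.toNNReal ω)) volume 0 T := by
  rw [intervalIntegrable_iff_integrableOn_Ioc_of_le T.coe_nonneg]
  exact ⟨(measurable_comp_path hX hm hV ω).aestronglyMeasurable, h⟩

theorem IsMarkovFamily.ae_lintegral_lt_top (hP : IsMarkovFamily ℱ X p P) {μ : Measure S}
    [IsProbabilityMeasure μ] (hinv : IsInvariantMeasure p μ) (hV : Measurable V)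
    (hVi : Integrable V μ) (T : ℝ≥0) :
    ∀ᵐ ω ∂P.init μ, ∫⁻ r in Set.Ioc (0 : ℝ) T, ‖V (X r.toNNReal ω)‖ₑ < ⊤ := by
  refine ae_lt_top' ?_ ?_
  · exact (measurable_occupation_of_uncurry (hP.cadlag.measurable_uncurry hP.measurable)
      hV.enorm T).aemeasurable
  · rw [hP.lintegral_occupation hinv hV.enorm]
    exact ENNReal.mul_ne_top ENNReal.coe_ne_top hVi.2.ne

/-- The exponential bound is stable under approximation of the observable in `L¹(μ)`. -/
theorem IsMarkovFamily.lintegral_init_exp_le_of_tendsto (hP : IsMarkovFamily ℱ X p P)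
    {μ : Measure S} [IsProbabilityMeasure μ] (hinv : IsInvariantMeasure p μ) {β : ℝ}
    {Vn : ℕ → S → ℝ} (hVn : ∀ n, Measurable (Vn n)) (hVni : ∀ n, Integrable (Vn n) μ)
    (hV : Measurable V) (hVi : Integrable V μ) (he : Integrable (fun x => Real.exp (β * V x)) μ)
    (hL1 : Tendsto (fun n => ∫⁻ x, ‖Vn n x - V x‖ₑ ∂μ) atTop (𝓝 0))
    (hexp : Tendsto (fun n => ∫ x, Real.exp (β * Vn n x) ∂μ) atTop
      (𝓝 (∫ x, Real.exp (β * V x) ∂μ))) (T : ℝ≥0)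
    (hbd : ∀ n, ∫⁻ ω, ENNReal.ofReal (Real.exp (pathIntegral X (Vn n) 0 T ω)) ∂P.init μ ≤
      ENNReal.ofReal (Real.exp (T * (1 / β * Real.log (∫ x, Real.exp (β * Vn n x) ∂μ))))) :
    ∫⁻ ω, ENNReal.ofReal (Real.exp (pathIntegral X V 0 T ω)) ∂P.init μ ≤
      ENNReal.ofReal (Real.exp (T * (1 / β * Real.log (∫ x, Real.exp (β * V x) ∂μ)))) := by
  have := P.isProbabilityMeasure_init μ
  have hX := hP.cadlag
  have hm := hP.measurable
  have hmeas : ∀ W : S → ℝ, Measurable W → Measurable (pathIntegral X W 0 T) := fun W hW =>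
    measurable_pathIntegral hX hm hW 0 T
  -- By stationarity the path integrals differ in `L¹` by at most `T` times the `L¹(μ)` distance of
  -- the observables.
  have hdiff : ∀ n, eLpNorm (pathIntegral X (Vn n) 0 T - pathIntegral X V 0 T) 1 (P.init μ) ≤
      T * ∫⁻ x, ‖Vn n x - V x‖ₑ ∂μ := by
    intro n
    rw [eLpNorm_one_eq_lintegral_enorm,
      ← hP.lintegral_occupation hinv (g := fun x => ‖Vn n x - V x‖ₑ) ((hVn n).sub hV).enorm]
    refine lintegral_mono_ae ?_
    filter_upwards [hP.ae_lintegral_lt_top hinv (hVn n) (hVni n) T,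
      hP.ae_lintegral_lt_top hinv hV hVi T] with ω h1 h2
    rw [Pi.sub_apply, pathIntegral, pathIntegral, ← intervalIntegral.integral_sub
      (intervalIntegrable_comp_path_of_lintegral_lt_top hX hm (hVn n) h1)
      (intervalIntegrable_comp_path_of_lintegral_lt_top hX hm hV h2),
      intervalIntegral.integral_of_le T.coe_nonneg]
    exact enorm_integral_le_lintegral_enorm _
  have hconv : Tendsto (fun n => eLpNorm (pathIntegral X (Vn n) 0 T - pathIntegral X V 0 T) 1
      (P.init μ)) atTop (𝓝 0) := by
    have h := ENNReal.Tendsto.const_mul (a := (T : ℝ≥0∞)) hL1 (Or.inr ENNReal.coe_ne_top)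
    rw [mul_zero] at h
    exact tendsto_of_tendsto_of_tendsto_of_le_of_le tendsto_const_nhds h (fun _ => zero_le) hdiff
  -- Almost sure convergence along a subsequence is all that Fatou's lemma needs.
  obtain ⟨ns, hns, hae⟩ := (tendstoInMeasure_of_tendsto_eLpNorm one_ne_zero
    (fun n => (hmeas _ (hVn n)).aestronglyMeasurable) (hmeas _ hV).aestronglyMeasurable
    hconv).exists_seq_tendsto_ae
  have hκ : Tendsto (fun k => ENNReal.ofReal (Real.exp (T * (1 / β *
      Real.log (∫ x, Real.exp (β * Vn (ns k) x) ∂μ))))) atTop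
      (𝓝 (ENNReal.ofReal (Real.exp (T * (1 / β * Real.log (∫ x, Real.exp (β * V x) ∂μ)))))) := by
    refine (ENNReal.continuous_ofReal.comp Real.continuous_exp).continuousAt.tendsto.comp ?_
    exact ((((Real.continuousAt_log (integral_exp_pos he).ne').tendsto.comp hexp).comp
      hns.tendsto_atTop).const_mul _).const_mul _
  calc ∫⁻ ω, ENNReal.ofReal (Real.exp (pathIntegral X V 0 T ω)) ∂P.init μ
      = ∫⁻ ω, liminf (fun k => ENNReal.ofReal (Real.exp (pathIntegral X (Vn (ns k)) 0 T ω))) atTop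
          ∂P.init μ := by
        refine lintegral_congr_ae ?_
        filter_upwards [hae] with ω hω
        exact (((ENNReal.continuous_ofReal.comp Real.continuous_exp).continuousAt.tendsto.comp
          hω).liminf_eq).symm
    _ ≤ liminf (fun k => ∫⁻ ω, ENNReal.ofReal (Real.exp (pathIntegral X (Vn (ns k)) 0 T ω))
          ∂P.init μ) atTop :=
        lintegral_liminf_le fun k => (hmeas _ (hVn _)).exp.ennreal_ofReal
    _ ≤ liminf (fun k => ENNReal.ofReal (Real.exp (T * (1 / β *
          Real.log (∫ x, Real.exp (β * Vn (ns k) x) ∂μ))))) atTop :=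
        liminf_le_liminf (Eventually.of_forall fun k => hbd _)
    _ = _ := hκ.liminf_eq

theorem abs_clamp_le {M : ℝ} (hM : 0 ≤ M) (a : ℝ) : |max (-M) (min a M)| ≤ M :=
  abs_le.2 ⟨le_max_left _ _, max_le (by linarith) (min_le_right _ _)⟩

theorem clamp_eq_self {M a : ℝ} (h : |a| ≤ M) : max (-M) (min a M) = a := by
  rw [min_eq_left (abs_le.1 h).2, max_eq_right (abs_le.1 h).1]

theorem abs_clamp_sub_clamp_le (M a b : ℝ) :
    |max (-M) (min a M) - max (-M) (min b M)| ≤ |a - b| := by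
  have h1 := abs_max_sub_max_le_abs (min a M) (min b M) (-M)
  have h2 := abs_min_sub_min_le_max a M b M
  rw [max_comm (min a M), max_comm (min b M)] at h1
  refine h1.trans (h2.trans ?_)
  simp

/-- Bounded continuous functions are dense in `L¹(μ)`. Clamping the approximants to `[-M, M]` does
not increase the error, and on that range `exp` is Lipschitz, so the exponential moments converge as
well. -/
theorem IsMarkovFamily.lintegral_init_exp_le_of_bounded (hP : IsMarkovFamily ℱ X p P)
    {μ : Measure S} [IsProbabilityMeasure μ] (hinv : IsInvariantMeasure p μ) {β : ℝ} (hβ : 0 < β)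
    (hLS : LogSobolev p μ β) (hV : Measurable V) (hM : ∀ x, |V x| ≤ M) (T : ℝ≥0) :
    ∫⁻ ω, ENNReal.ofReal (Real.exp (pathIntegral X V 0 T ω)) ∂P.init μ ≤
      ENNReal.ofReal (Real.exp (T * (1 / β * Real.log (∫ x, Real.exp (β * V x) ∂μ)))) := by
  obtain ⟨x₀⟩ : Nonempty S := nonempty_of_isProbabilityMeasure μ
  have hM0 : 0 ≤ M := (abs_nonneg _).trans (hM x₀)
  have hVi : Integrable V μ :=
    Integrable.of_bound hV.aestronglyMeasurable M (Eventually.of_forall hM)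
  let := TopologicalSpace.upgradeIsCompletelyMetrizable S
  have happ : ∀ n : ℕ, ∃ W : S → ℝ, Continuous W ∧ (∀ x, |W x| ≤ M) ∧
      ∫⁻ x, ‖W x - V x‖ₑ ∂μ ≤ ENNReal.ofReal (1 / ((n : ℝ) + 1)) := by
    intro n
    obtain ⟨g, hg, -⟩ := (memLp_one_iff_integrable.2 hVi).exists_boundedContinuous_eLpNorm_sub_le
      ENNReal.one_ne_top (ε := ENNReal.ofReal (1 / ((n : ℝ) + 1)))
      (by rw [Ne, ENNReal.ofReal_eq_zero, not_le]; positivity)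
    refine ⟨fun x => max (-M) (min (g x) M), by fun_prop, fun x => abs_clamp_le hM0 _, ?_⟩
    rw [eLpNorm_one_eq_lintegral_enorm] at hg
    refine (lintegral_mono fun x => ?_).trans hg
    rw [enorm_le_iff_norm_le, Pi.sub_apply, Real.norm_eq_abs, Real.norm_eq_abs, abs_sub_comm (V x)]
    nth_rewrite 1 [← clamp_eq_self (hM x)]
    exact abs_clamp_sub_clamp_le _ _ _
  choose W hWc hWb hWV using happ
  have hL1 : Tendsto (fun n => ∫⁻ x, ‖W n x - V x‖ₑ ∂μ) atTop (𝓝 0) := by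
    refine tendsto_of_tendsto_of_tendsto_of_le_of_le tendsto_const_nhds ?_ (fun _ => zero_le) hWV
    have := ENNReal.tendsto_ofReal (tendsto_one_div_add_atTop_nhds_zero_nat (𝕜 := ℝ))
    rwa [ENNReal.ofReal_zero] at this
  have hei : ∀ U : S → ℝ, Measurable U → (∀ x, |U x| ≤ M) →
      Integrable (fun x => Real.exp (β * U x)) μ := fun U hU hUM =>
    Integrable.of_bound (hU.const_mul β).exp.aestronglyMeasurable (Real.exp (β * M))
      (Eventually.of_forall fun x => by
        rw [Real.norm_eq_abs, Real.abs_exp]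
        exact Real.exp_le_exp.2 (mul_le_mul_of_nonneg_left ((le_abs_self _).trans (hUM x)) hβ.le))
  have hWi : ∀ n, Integrable (W n) μ := fun n =>
    Integrable.of_bound (hWc n).measurable.aestronglyMeasurable M (Eventually.of_forall (hWb n))
  refine hP.lintegral_init_exp_le_of_tendsto hinv (fun n => (hWc n).measurable) hWi hV hVi
    (hei V hV hM) hL1 ?_ T
    fun n => hP.lintegral_init_exp_le_of_continuous hβ hLS (hWc n) (hWb n) T
  refine tendsto_integral_of_L1 _ (hei V hV hM).1
    (Eventually.of_forall fun n => hei _ (hWc n).measurable (hWb n)) ?_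
  have h := ENNReal.Tendsto.const_mul (a := ENNReal.ofReal (Real.exp (β * M) * β)) hL1
    (Or.inr ENNReal.ofReal_ne_top)
  rw [mul_zero] at h
  refine tendsto_of_tendsto_of_tendsto_of_le_of_le tendsto_const_nhds h (fun _ => zero_le)
    fun n => ?_
  simp only
  rw [← lintegral_const_mul' _ _ ENNReal.ofReal_ne_top]
  refine lintegral_mono fun x => ?_
  rw [← ofReal_norm, ← ofReal_norm (W n x - V x), ← ENNReal.ofReal_mul (by positivity)]
  refine ENNReal.ofReal_le_ofReal ?_
  have hb : ∀ U : S → ℝ, |U x| ≤ M → |β * U x| ≤ β * M := fun U hU => by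
    rw [abs_mul, abs_of_pos hβ]
    gcongr
  refine (abs_exp_sub_exp_le (hb _ (hWb n x)) (hb _ (hM x))).trans_eq ?_
  rw [← mul_sub, abs_mul, abs_of_pos hβ, mul_assoc, Real.norm_eq_abs]

/-- The logarithmic Sobolev bound for exponential moments of time integrals. -/
theorem IsMarkovFamily.lintegral_init_exp_le (hP : IsMarkovFamily ℱ X p P)
    {μ : Measure S} [IsProbabilityMeasure μ] (hinv : IsInvariantMeasure p μ) {β : ℝ} (hβ : 0 < β)
    (hLS : LogSobolev p μ β) (hV : Measurable V) (hVi : Integrable V μ)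
    (he : Integrable (fun x => Real.exp (β * V x)) μ) (T : ℝ≥0) :
    ∫⁻ ω, ENNReal.ofReal (Real.exp (pathIntegral X V 0 T ω)) ∂P.init μ ≤
      ENNReal.ofReal (Real.exp (T * (1 / β * Real.log (∫ x, Real.exp (β * V x) ∂μ)))) := by
  set W : ℕ → S → ℝ := fun n x => max (-(n : ℝ)) (min (V x) n) with hW
  have hWm : ∀ n, Measurable (W n) := fun n =>
    measurable_const.max (hV.min measurable_const)
  have hWb : ∀ n x, |W n x| ≤ n := fun n x => abs_clamp_le n.cast_nonneg _
  have hWlim : ∀ x, ∀ᶠ n in atTop, W n x = V x := fun x => by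
    obtain ⟨N, hN⟩ := exists_nat_ge |V x|
    filter_upwards [eventually_ge_atTop N] with n hn
    exact clamp_eq_self (hN.trans (by exact_mod_cast hn))
  have hWV : ∀ n x, |W n x - V x| ≤ |V x| := fun n x => by
    simp only [hW]
    have hn : (0 : ℝ) ≤ n := n.cast_nonneg
    rcases le_total (V x) n with h1 | h1
    · rw [min_eq_left h1]
      rcases le_total (-(n : ℝ)) (V x) with h2 | h2
      · rw [max_eq_right h2]; simp
      · rw [max_eq_left h2, abs_of_nonneg (by linarith), abs_of_nonpos (by linarith)]; linarith
    · rw [min_eq_right h1, max_eq_right (by linarith), abs_of_nonpos (by linarith),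
        abs_of_nonneg (by linarith)]
      linarith
  refine hP.lintegral_init_exp_le_of_tendsto hinv hWm (fun n =>
    Integrable.of_bound (hWm n).aestronglyMeasurable n (Eventually.of_forall (hWb n))) hV hVi he
    ?_ ?_ T fun n => hP.lintegral_init_exp_le_of_bounded hinv hβ hLS (hWm n) (hWb n) T
  · have := tendsto_lintegral_of_dominated_convergence (μ := μ) (F := fun n x => ‖W n x - V x‖ₑ)
      (f := fun _ => 0) (fun x => ‖V x‖ₑ) (fun n => ((hWm n).sub hV).enorm)
      (fun n => Eventually.of_forall fun x => enorm_le_iff_norm_le.2 (hWV n x)) hVi.2.ne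
      (Eventually.of_forall fun x => tendsto_const_nhds.congr' (by
        filter_upwards [hWlim x] with n hn
        simp [hn]))
    simpa using this
  · refine tendsto_integral_of_dominated_convergence (fun x => Real.exp (β * V x) + 1)
      (fun n => ((hWm n).const_mul β).exp.aestronglyMeasurable) (he.add (integrable_const 1))
      (fun n => Eventually.of_forall fun x => ?_) (Eventually.of_forall fun x => ?_)
    · rw [Real.norm_eq_abs, Real.abs_exp]
      have hn : (0 : ℝ) ≤ n := n.cast_nonneg
      -- Truncation can raise `V` only to a nonpositive level, so `exp(β V) + 1` dominates all
      -- truncations.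
      have : W n x ≤ V x ∨ W n x ≤ 0 := by
        simp only [hW]
        rcases le_total (-(n : ℝ)) (V x) with h2 | h2
        · exact Or.inl (max_le h2 (min_le_left _ _))
        · exact Or.inr (max_le (by linarith) ((min_le_left _ _).trans (by linarith)))
      rcases this with h | h
      · have := Real.exp_le_exp.2 (mul_le_mul_of_nonneg_left h hβ.le)
        linarith
      · have := Real.exp_le_one_iff.2 (mul_nonpos_of_nonneg_of_nonpos hβ.le h)
        linarith [Real.exp_pos (β * V x)]
    · exact tendsto_const_nhds.congr' (by
        filter_upwards [hWlim x] with n hn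
        rw [hn])

end Extension

/-! ### Relative entropy: integrability and the Gibbs variational inequality. -/

section Gibbs

variable {α : Type*} {mα : MeasurableSpace α} {Q P : Measure α} [IsProbabilityMeasure Q]
  [IsProbabilityMeasure P] {Y : α → ℝ}

theorem integrable_klFun_of_klDiv_ne_top (h : InformationTheory.klDiv Q P ≠ ⊤) :
    Integrable (fun x => InformationTheory.klFun (Q.rnDeriv P x).toReal) P :=
  have h' := InformationTheory.klDiv_ne_top_iff.1 h
  (InformationTheory.integrable_klFun_rnDeriv_iff h'.1).2 h'.2

theorem mul_le_klFun_add_exp {a : ℝ} (ha : 0 ≤ a) (b : ℝ) :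
    a * b ≤ InformationTheory.klFun a - 1 + Real.exp b := by
  have := mul_le_mul_log_sub_add_exp ha b
  rw [InformationTheory.klFun]
  linarith

/-- A function with two-sided exponential moments under `P` is integrable under every `Q` of finite
relative entropy. -/
theorem integrable_of_klDiv_ne_top (h : InformationTheory.klDiv Q P ≠ ⊤)
    (hY : AEStronglyMeasurable Y P) (h1 : Integrable (fun x => Real.exp (Y x)) P)
    (h2 : Integrable (fun x => Real.exp (-Y x)) P) : Integrable Y Q := by
  have h' := InformationTheory.klDiv_ne_top_iff.1 h
  rw [← integrable_rnDeriv_smul_iff h'.1]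
  refine ((integrable_klFun_of_klDiv_ne_top h).add (h1.add h2)).mono'
    ((Q.measurable_rnDeriv P).ennreal_toReal.aestronglyMeasurable.smul hY)
    (Eventually.of_forall fun x => ?_)
  have h0 : 0 ≤ (Q.rnDeriv P x).toReal := ENNReal.toReal_nonneg
  -- Young's inequality for `Y` and for `-Y` bounds the density times `|Y|` by `P`-integrable
  -- functions.
  have hp := mul_le_klFun_add_exp h0 (Y x)
  have hn := mul_le_klFun_add_exp h0 (-Y x)
  have e1 := Real.exp_pos (Y x)
  have e2 := Real.exp_pos (-Y x)
  simp only [Pi.add_apply, smul_eq_mul, norm_mul, Real.norm_eq_abs, abs_of_nonneg h0]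
  rcases abs_cases (Y x) with ⟨h, -⟩ | ⟨h, -⟩ <;> rw [h] <;> linarith

/-- The Gibbs variational inequality. -/
theorem integral_le_klDiv_add (h : InformationTheory.klDiv Q P ≠ ⊤) (hY : Integrable Y Q)
    (h1 : Integrable (fun x => Real.exp (Y x)) P) {a : ℝ}
    (ha : ∫ x, Real.exp (Y x) ∂P ≤ Real.exp a) :
    ∫ x, Y x ∂Q ≤ (InformationTheory.klDiv Q P).toReal + a := by
  have h' := InformationTheory.klDiv_ne_top_iff.1 h
  rw [InformationTheory.toReal_klDiv_eq_integral_klFun h'.1]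
  have hk := integrable_klFun_of_klDiv_ne_top h
  have he : Integrable (fun x => Real.exp (-a) * Real.exp (Y x)) P := h1.const_mul _
  have hint : Integrable (fun x => Y x - a) Q := hY.sub (integrable_const a)
  -- Young's inequality against the density, with `Y` shifted by `a`: the constant `-1` then absorbs
  -- `exp(-a) ∫ exp Y dP ≤ 1`.
  have key : ∫ x, (Q.rnDeriv P x).toReal • (Y x - a) ∂P ≤
      ∫ x, InformationTheory.klFun (Q.rnDeriv P x).toReal - 1 + Real.exp (-a) * Real.exp (Y x)
        ∂P := by
    refine integral_mono ((integrable_rnDeriv_smul_iff h'.1).2 hint)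
      ((hk.sub (integrable_const 1)).add he) fun x => ?_
    have := mul_le_klFun_add_exp (ENNReal.toReal_nonneg (a := Q.rnDeriv P x)) (Y x - a)
    simp only [smul_eq_mul]
    rwa [sub_eq_neg_add, Real.exp_add, ← sub_eq_neg_add] at this
  rw [integral_rnDeriv_smul h'.1, integral_sub hY (integrable_const a),
    integral_add (f := fun x => InformationTheory.klFun (Q.rnDeriv P x).toReal - 1)
      (hk.sub (integrable_const 1)) he, integral_sub hk (integrable_const 1),
    integral_const_mul] at key
  simp only [integral_const, probReal_univ, smul_eq_mul, one_mul] at key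
  have : Real.exp (-a) * ∫ x, Real.exp (Y x) ∂P ≤ 1 := by
    rw [Real.exp_neg, inv_mul_le_iff₀ (Real.exp_pos a), mul_one]
    exact ha
  linarith

end Gibbs

/-! ### The bound at a fixed parameter, on the σ-algebra at time `T`. -/

section UQ

variable {S Ω : Type*} [TopologicalSpace S] [PolishSpace S] [MeasurableSpace S] [BorelSpace S]
  [mΩ : MeasurableSpace Ω] {ℱ : Filtration ℝ≥0 mΩ} {X : ℝ≥0 → Ω → S} {p : ℝ≥0 → S → Measure S}
  {P : PathFamily X}

/-- The stopped process is progressively measurable. -/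
theorem IsMarkovFamily.measurable_uncurry_stopped (hP : IsMarkovFamily ℱ X p P) (T : ℝ≥0) :
    @Measurable _ _ (@Prod.instMeasurableSpace ℝ Ω _ (ℱ T)) _
      (fun q : ℝ × Ω => X (min q.1.toNNReal T) q.2) := by
  refine @measurable_uncurry_toNNReal_of_rightContinuous _ _ _ _ _ _ (ℱ T)
    (fun t => X (min t T)) (fun t => ?_) fun ω t => ?_
  · exact (hP.adapted (min t T)).mono (ℱ.mono (min_le_right t T)) le_rfl
  · exact (hP.cadlag.continuousWithinAt ω (min t T)).comp (f := fun s => min s T)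
      (by fun_prop) fun s hs => min_le_min_right T hs

theorem min_toNNReal_eq {T : ℝ≥0} {r : ℝ} (hr : r ≤ T) : min r.toNNReal T = r.toNNReal :=
  min_eq_left (Real.toNNReal_le_iff_le_coe.2 hr)

/-- On `[0, T]` the path agrees with the path stopped at `T`, which is jointly measurable for `ℱ T`.
This places time averages where the restricted entropy applies. -/
theorem IsMarkovFamily.measurable_pathIntegral_filtration (hP : IsMarkovFamily ℱ X p P)
    {V : S → ℝ} (hV : Measurable V) (T : ℝ≥0) : Measurable[ℱ T] (pathIntegral X V 0 T) := by
  have h := @measurable_pathIntegral_of_uncurry _ _ _ _ _ _ (ℱ T) (fun t => X (min t T)) V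
    (hP.measurable_uncurry_stopped T) hV 0 T
  convert h using 1
  ext ω
  refine intervalIntegral.integral_congr fun r hr => ?_
  rw [Set.uIcc_of_le T.coe_nonneg] at hr
  simp only [min_toNNReal_eq hr.2]

theorem IsMarkovFamily.measurable_occupation_filtration (hP : IsMarkovFamily ℱ X p P)
    {g : S → ℝ≥0∞} (hg : Measurable g) (T : ℝ≥0) :
    Measurable[ℱ T] fun ω => ∫⁻ r in Set.Ioc (0 : ℝ) T, g (X r.toNNReal ω) := by
  have h := @measurable_occupation_of_uncurry _ _ _ _ _ _ (ℱ T) (fun t => X (min t T))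
    (hP.measurable_uncurry_stopped T) g hg T
  convert h using 1
  ext ω
  refine setLIntegral_congr_fun measurableSet_Ioc fun r hr => ?_
  simp only [min_toNNReal_eq hr.2]

/-- Almost sure properties of events in `ℱ T` transfer along finite relative entropy. -/
theorem ae_of_relEntropy_ne_top {T : ℝ≥0} {Q P : Measure Ω} (h : relEntropy ℱ T Q P ≠ ⊤)
    {s : Set Ω} (hs : MeasurableSet[ℱ T] s) (hPs : ∀ᵐ ω ∂P, ω ∈ s) : ∀ᵐ ω ∂Q, ω ∈ s := by
  have hac := (InformationTheory.klDiv_ne_top_iff.1 h).1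
  have h1 : P.trim (ℱ.le T) sᶜ = 0 := by
    rw [trim_measurableSet_eq (ℱ.le T) hs.compl]
    exact hPs
  have h2 := hac h1
  rwa [trim_measurableSet_eq (ℱ.le T) hs.compl] at h2

/-- Time averages of almost everywhere equal observables agree. -/
theorem IsMarkovFamily.ae_path_of_relEntropy_ne_top (hP : IsMarkovFamily ℱ X p P)
    {μ : Measure S} [IsProbabilityMeasure μ] (hinv : IsInvariantMeasure p μ) {f f' : S → ℝ}
    (hf' : Measurable f') (hfi : Integrable f' μ) (hff' : f =ᵐ[μ] f') {T : ℝ≥0} {Q : Measure Ω}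
    (h : relEntropy ℱ T Q (P.init μ) ≠ ⊤) :
    ∀ᵐ ω ∂Q, IntervalIntegrable (fun t : ℝ => f (X t.toNNReal ω)) volume 0 T ∧
      timeAvg X f T ω = 1 / (T : ℝ) * pathIntegral X f' 0 T ω := by
  -- The stationary process spends almost surely zero time in a `μ`-null Borel set `N`. That event
  -- lies in `ℱ T`, so it passes to `Q`.
  obtain ⟨N, hN, hNm, hN0⟩ := exists_measurable_superset_of_null hff'
  have hgm : Measurable (N.indicator fun _ => (1 : ℝ≥0∞)) := measurable_one.indicator hNm
  have m1 := hP.measurable_occupation_filtration hgm T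
  have m2 := hP.measurable_occupation_filtration hf'.enorm T
  have p1 : ∀ᵐ ω ∂P.init μ, ω ∈ {ω | ∫⁻ r in Set.Ioc (0 : ℝ) T,
      N.indicator (fun _ => (1 : ℝ≥0∞)) (X r.toNNReal ω) = 0} := by
    have := (lintegral_eq_zero_iff (m1.mono (ℱ.le T) le_rfl)).1
      ((hP.lintegral_occupation hinv hgm T).trans (by
        rw [lintegral_indicator_const hNm, hN0]; simp))
    exact this
  have q1 := ae_of_relEntropy_ne_top h (m1 (measurableSet_singleton 0)) p1
  have q2 := ae_of_relEntropy_ne_top h (m2 measurableSet_Iio)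
    (hP.ae_lintegral_lt_top hinv hf' hfi T)
  filter_upwards [q1, q2] with ω h1 h2
  have i2 := intervalIntegrable_comp_path_of_lintegral_lt_top hP.cadlag hP.measurable hf' h2
  have hmω : Measurable fun r : ℝ => N.indicator (fun _ => (1 : ℝ≥0∞)) (X r.toNNReal ω) :=
    hgm.comp ((hP.cadlag.measurable_uncurry hP.measurable).comp
      (measurable_id.prodMk measurable_const))
  have hae : ∀ᵐ r : ℝ, r ∈ Set.uIoc (0 : ℝ) T → f' (X r.toNNReal ω) = f (X r.toNNReal ω) := by
    rw [Set.uIoc_of_le T.coe_nonneg, ← ae_restrict_iff'₀ measurableSet_Ioc.nullMeasurableSet]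
    filter_upwards [(lintegral_eq_zero_iff hmω).1 h1] with r hr
    by_contra hne
    have : X r.toNNReal ω ∈ N := hN fun h' => hne (h' : f _ = f' _).symm
    simp [this] at hr
  refine ⟨i2.congr_ae ((ae_restrict_iff'₀ measurableSet_uIoc.nullMeasurableSet).2 hae), ?_⟩
  rw [timeAvg, pathIntegral, intervalIntegral.integral_congr_ae hae]

/-- The uncertainty quantification bound at a fixed parameter `c`. -/
theorem IsMarkovFamily.uq_bound (hP : IsMarkovFamily ℱ X p P)
    {μ : Measure S} [IsProbabilityMeasure μ] (hinv : IsInvariantMeasure p μ) {β : ℝ} (hβ : 0 < β)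
    (hLS : LogSobolev p μ β) {f : S → ℝ} (hf : Integrable f μ) {D : Set ℝ}
    (hD : ∃ c ∈ D, c ≠ 0)
    (hint : ∀ c ∈ D, Integrable (fun x => Real.exp (β * centered μ f c x)) μ ∧
      Integrable (fun x => Real.exp (β * centered μ f (-c) x)) μ)
    {T : ℝ≥0} (hT : 0 < T) {Q : Measure Ω} [IsProbabilityMeasure Q]
    (h : relEntropy ℱ T Q (P.init μ) ≠ ⊤) :
    (∀ᵐ ω ∂Q, IntervalIntegrable (fun t : ℝ => f (X t.toNNReal ω)) volume 0 T) ∧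
    Integrable (timeAvg X f T) Q ∧
    ∀ c ∈ D, c * ((∫ ω, timeAvg X f T ω ∂Q) - ∫ x, f x ∂μ) ≤
      logMoment μ β f c + (relEntropy ℱ T Q (P.init μ)).toReal / T := by
  have := P.isProbabilityMeasure_init μ
  have : IsProbabilityMeasure ((P.init μ).trim (ℱ.le T)) :=
    ⟨by rw [trim_measurableSet_eq _ MeasurableSet.univ]; exact measure_univ⟩
  have : IsProbabilityMeasure (Q.trim (ℱ.le T)) :=
    ⟨by rw [trim_measurableSet_eq _ MeasurableSet.univ]; exact measure_univ⟩
  have hT' : (0 : ℝ) < T := hT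
  obtain ⟨f', hf'm, hff'⟩ := hf.1.aemeasurable
  have hfi' : Integrable f' μ := hf.congr hff'
  set m := ∫ x, f x ∂μ with hm
  have hpath := hP.ae_path_of_relEntropy_ne_top hinv hf'm hfi' hff' h
  set A : Ω → ℝ := fun ω => 1 / (T : ℝ) * pathIntegral X f' 0 T ω with hA
  have hAm : Measurable[ℱ T] A :=
    (hP.measurable_pathIntegral_filtration hf'm T).const_mul _
  -- `Y c` agrees `P.init μ`-almost surely with the path integral of `V_c`.
  set Y : ℝ → Ω → ℝ := fun c ω => c * (T * (A ω - m)) with hY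
  have hYm : ∀ c, Measurable[ℱ T] (Y c) := fun c => ((hAm.sub_const m).const_mul _).const_mul c
  have hexp : ∀ c, Integrable (fun x => Real.exp (β * centered μ f c x)) μ →
      Integrable (fun ω => Real.exp (Y c ω)) ((P.init μ).trim (ℱ.le T)) ∧
      ∫ ω, Real.exp (Y c ω) ∂(P.init μ).trim (ℱ.le T) ≤ Real.exp (T * logMoment μ β f c) := by
    intro c hc
    have hae : (fun x => Real.exp (β * centered μ f c x)) =ᵐ[μ]
        fun x => Real.exp (β * (c * (f' x - m))) := by
      filter_upwards [hff'] with x hx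
      rw [centered, hx]
    have hb := hP.lintegral_init_exp_le hinv hβ hLS (V := fun x => c * (f' x - m))
      ((hf'm.sub_const m).const_mul c) ((hfi'.sub (integrable_const m)).const_mul c)
      (hc.congr hae) T
    rw [← integral_congr_ae hae] at hb
    have hYe : ∀ᵐ ω ∂P.init μ, pathIntegral X (fun x => c * (f' x - m)) 0 T ω = Y c ω := by
      filter_upwards [hP.ae_lintegral_lt_top hinv hf'm hfi' T] with ω hω
      have hi := intervalIntegrable_comp_path_of_lintegral_lt_top hP.cadlag hP.measurable hf'm hω
      simp only [hY, hA, pathIntegral]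
      rw [intervalIntegral.integral_const_mul, intervalIntegral.integral_sub hi (by simp),
        intervalIntegral.integral_const, smul_eq_mul]
      field_simp
      ring
    rw [lintegral_congr_ae (hYe.mono fun ω hω => by rw [hω]),
      ← lintegral_trim (ℱ.le T) (hYm c).exp.ennreal_ofReal] at hb
    have hi : Integrable (fun ω => Real.exp (Y c ω)) ((P.init μ).trim (ℱ.le T)) := by
      refine ⟨(hYm c).exp.aestronglyMeasurable, ?_⟩
      rw [hasFiniteIntegral_iff_ofReal (Eventually.of_forall fun ω => (Real.exp_pos _).le)]
      exact hb.trans_lt ENNReal.ofReal_lt_top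
    refine ⟨hi, ?_⟩
    rwa [← ofReal_integral_eq_lintegral_ofReal hi
      (Eventually.of_forall fun ω => (Real.exp_pos _).le),
      ENNReal.ofReal_le_ofReal_iff (Real.exp_pos _).le] at hb
  have hYneg : ∀ c ω, Y (-c) ω = -Y c ω := fun c ω => by simp only [hY]; ring
  -- Integrability under `Q` needs exponential moments at both `c` and `-c`, and `-c` may lie
  -- outside `D`.
  have hYi : ∀ c ∈ D, Integrable (Y c) (Q.trim (ℱ.le T)) := fun c hc => by
    refine integrable_of_klDiv_ne_top h (hYm c).aestronglyMeasurable (hexp c (hint c hc).1).1 ?_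
    simpa only [hYneg] using (hexp (-c) (hint c hc).2).1
  have hAi : Integrable A Q := by
    obtain ⟨c, hcD, hc0⟩ := hD
    have h1 : Integrable (Y c) Q := integrable_of_integrable_trim (ℱ.le T) (hYi c hcD)
    refine ((h1.const_mul (c * T)⁻¹).add (integrable_const m)).congr (Eventually.of_forall fun ω => ?_)
    simp only [hY, Pi.add_apply]
    field_simp
    ring
  have hAe : timeAvg X f T =ᵐ[Q] A := hpath.mono fun ω hω => hω.2
  refine ⟨hpath.mono fun ω hω => hω.1, hAi.congr hAe.symm, fun c hc => ?_⟩
  have hfin := integral_le_klDiv_add h (hYi c hc) (hexp c (hint c hc).1).1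
    (hexp c (hint c hc).1).2
  rw [← integral_trim (ℱ.le T) (hYm c).stronglyMeasurable] at hfin
  simp only [hY, integral_const_mul] at hfin
  rw [integral_sub hAi (integrable_const m), integral_const, probReal_univ, one_smul] at hfin
  rw [integral_congr_ae hAe, ← sub_le_iff_le_add', le_div_iff₀ hT']
  change _ ≤ (InformationTheory.klDiv _ _).toReal
  linarith

end UQ

/-! ### Behaviour of the logarithmic moment at zero. -/

section LogMoment

variable {S : Type*} [MeasurableSpace S] {μ : Measure S} [IsProbabilityMeasure μ] {β : ℝ}
  {f : S → ℝ}

/-- Regularity and derivatives at `0` are thereby inherited from the cumulant generating function,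
which is analytic in the interior of its integrability domain. -/
theorem logMoment_eq_cgf (μ : Measure S) (β : ℝ) (f : S → ℝ) :
    logMoment μ β f = fun c => 1 / β * cgf (fun x => f x - ∫ y, f y ∂μ) μ (β * c) := by
  ext c
  simp only [logMoment, centered, cgf, mgf, mul_assoc]

theorem zero_mem_interior_integrableExpSet (hβ : 0 < β) {ε : ℝ} (hε : 0 < ε)
    (h : ∀ c, |c| < ε → Integrable (fun x => Real.exp (β * centered μ f c x)) μ) :
    0 ∈ interior (integrableExpSet (fun x => f x - ∫ y, f y ∂μ) μ) := by
  rw [mem_interior_iff_mem_nhds]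
  refine Filter.mem_of_superset (Metric.ball_mem_nhds 0 (mul_pos hβ hε)) fun t ht => ?_
  rw [Metric.mem_ball, dist_zero_right, Real.norm_eq_abs] at ht
  have := h (t / β) (by rwa [abs_div, abs_of_pos hβ, div_lt_iff₀' hβ])
  refine this.congr (Eventually.of_forall fun x => ?_)
  simp only [centered]
  rw [← mul_assoc, mul_div_cancel₀ _ hβ.ne']

theorem logMoment_zero : logMoment μ β f 0 = 0 := by
  simp [logMoment, centered]

theorem memLp_two_of_zero_mem_interior
    (h0 : 0 ∈ interior (integrableExpSet (fun x => f x - ∫ y, f y ∂μ) μ)) :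
    MemLp f 2 μ := by
  have := (memLp_of_mem_interior_integrableExpSet h0 2).add (memLp_const (∫ y, f y ∂μ))
  refine this.ae_eq (Eventually.of_forall fun x => ?_)
  simp

theorem contDiffAt_logMoment
    (h0 : 0 ∈ interior (integrableExpSet (fun x => f x - ∫ y, f y ∂μ) μ)) :
    ContDiffAt ℝ 2 (logMoment μ β f) 0 := by
  rw [logMoment_eq_cgf]
  refine contDiffAt_const.mul (ContDiffAt.comp
    (g := cgf (fun x => f x - ∫ y, f y ∂μ) μ) (f := fun c => β * c) 0 ?_ (contDiffAt_const.mul contDiffAt_id))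
  rw [mul_zero]
  exact (analyticAt_cgf h0).contDiffAt

theorem deriv_logMoment
    (hβ : 0 < β) : deriv (logMoment μ β f) =
    fun c => deriv (cgf (fun x => f x - ∫ y, f y ∂μ) μ) (β * c) := by
  ext c
  rw [logMoment_eq_cgf, deriv_const_mul_field, deriv_comp_mul_left, smul_eq_mul, ← mul_assoc,
    one_div_mul_cancel hβ.ne', one_mul]

theorem integral_centered_eq_zero (hf : Integrable f μ) :
    ∫ x, (f x - ∫ y, f y ∂μ) ∂μ = 0 := by
  rw [integral_sub hf (integrable_const _)]
  simp

theorem deriv_logMoment_zero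
    (h0 : 0 ∈ interior (integrableExpSet (fun x => f x - ∫ y, f y ∂μ) μ))
    (hβ : 0 < β) (hf : Integrable f μ) :
    deriv (logMoment μ β f) 0 = 0 := by
  rw [deriv_logMoment hβ]
  simp only [mul_zero]
  rw [deriv_cgf_zero h0, integral_centered_eq_zero hf, zero_div]

theorem iteratedDeriv_two_cgf_zero
    (h0 : 0 ∈ interior (integrableExpSet (fun x => f x - ∫ y, f y ∂μ) μ))
    (hf : Integrable f μ) :
    iteratedDeriv 2 (cgf (fun x => f x - ∫ y, f y ∂μ) μ) 0 = Var[f; μ] := by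
  rw [iteratedDeriv_two_cgf h0, deriv_cgf_zero h0, integral_centered_eq_zero hf,
    variance_eq_integral hf.1.aemeasurable]
  simp

theorem deriv_deriv_logMoment_zero
    (h0 : 0 ∈ interior (integrableExpSet (fun x => f x - ∫ y, f y ∂μ) μ))
    (hβ : 0 < β) (hf : Integrable f μ) :
    deriv (deriv (logMoment μ β f)) 0 = β * Var[f; μ] := by
  rw [deriv_logMoment hβ, deriv_comp_mul_left, mul_zero, ← iteratedDeriv_two_cgf_zero h0 hf,
    iteratedDeriv_succ, iteratedDeriv_one, smul_eq_mul]

/-- Second order upper bound for the logarithmic moment near zero. -/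
theorem exists_logMoment_le
    (h0 : 0 ∈ interior (integrableExpSet (fun x => f x - ∫ y, f y ∂μ) μ))
    (hβ : 0 < β) (hf : Integrable f μ) {δ : ℝ} (hδ : 0 < δ) :
    ∃ c₀ > 0, ∀ c ∈ Set.Ioo 0 c₀, logMoment μ β f c ≤ (β * Var[f; μ] + δ) * c ^ 2 / 2 := by
  set Y := fun x => f x - ∫ y, f y ∂μ with hY
  have hcont : ContinuousAt (iteratedDeriv 2 (cgf Y μ)) 0 := by
    rw [iteratedDeriv_eq_iterate]
    exact (((analyticAt_cgf h0).deriv).deriv).continuousAt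
  have hlt : ∀ᶠ u in 𝓝 (0 : ℝ), iteratedDeriv 2 (cgf Y μ) u < Var[f; μ] + δ / β := by
    refine hcont.eventually_lt continuousAt_const ?_
    rw [iteratedDeriv_two_cgf_zero h0 hf]
    have := div_pos hδ hβ
    linarith
  obtain ⟨r, hr, hball⟩ := Metric.eventually_nhds_iff_ball.1
    (hlt.and (isOpen_interior.eventually_mem h0))
  have habs : ∀ u, 0 ≤ u → u < r → u ∈ Metric.ball (0 : ℝ) r := fun u hu hur => by
    rwa [Metric.mem_ball, dist_zero_right, Real.norm_eq_abs, abs_of_nonneg hu]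
  refine ⟨r / β, div_pos hr hβ, fun c hc => ?_⟩
  have hcβ : 0 < β * c := mul_pos hβ hc.1
  have hcr : β * c < r := (lt_div_iff₀' hβ).1 hc.2
  -- Taylor's formula with a second-order remainder at an intermediate point; centring removes the
  -- linear term.
  obtain ⟨u, hu, he⟩ := exists_cgf_eq_iteratedDeriv_two_cgf_mul (X := Y) (μ := μ) hcβ
    (integral_centered_eq_zero hf) fun s hs => (hball s (habs s hs.1 (hs.2.trans_lt hcr))).2
  have hlu := (hball u (habs u hu.1.le (hu.2.trans hcr))).1
  rw [logMoment_eq_cgf]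
  simp only
  rw [he]
  calc 1 / β * (iteratedDeriv 2 (cgf Y μ) u * (β * c) ^ 2 / 2)
      = β * iteratedDeriv 2 (cgf Y μ) u * (c ^ 2 / 2) := by field_simp
    _ ≤ β * (Var[f; μ] + δ / β) * (c ^ 2 / 2) := by gcongr
    _ = _ := by field_simp

end LogMoment

/-! ### The infimum over `c` and its linearization. -/

section Xi

variable {Λ : ℝ → EReal}

theorem XiPlus_le {c x η : ℝ} (hc : 0 < c) (h : Λ c ≤ (x : EReal)) :
    XiPlus Λ (η : EReal) ≤ (((x + η) / c : ℝ) : EReal) := by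
  refine (iInf₂_le c hc).trans ?_
  rw [EReal.coe_div, EReal.coe_add]
  exact EReal.div_le_div_right_of_nonneg (by exact_mod_cast hc.le) (add_le_add_left h _)

/-- Only finite `Λ c` and `η` need checking, since otherwise the numerator is `⊤`. With `Λ`
arbitrary, `XiMinus` is covered by reflecting the argument. -/
theorem le_XiPlus {x : ℝ} {η : ℝ≥0∞} (hΛ : ∀ c, Λ c ≠ ⊥)
    (h : η ≠ ⊤ → ∀ c > 0, ∀ l : ℝ, Λ c = l → c * x ≤ l + η.toReal) :
    (x : EReal) ≤ XiPlus Λ (η : EReal) := by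
  refine le_iInf₂ fun c hc => ?_
  rw [EReal.le_div_iff_mul_le (by exact_mod_cast hc) (EReal.coe_ne_top c)]
  by_cases hη : η = ⊤
  · rw [hη, EReal.coe_ennreal_top, EReal.add_top_of_ne_bot (hΛ c)]
    exact le_top
  rw [← EReal.coe_ennreal_toReal hη]
  induction hl : Λ c with
  | bot => exact absurd hl (hΛ c)
  | top =>
    rw [EReal.top_add_of_ne_bot (EReal.coe_ne_bot _)]
    exact le_top
  | coe l =>
    rw [mul_comm]
    exact_mod_cast h hη c hc l hl

/-- Linearization of `Ξ⁺` for a function with a quadratic upper bound at zero. -/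
theorem exists_isLittleO_XiPlus_le {v : ℝ} (hv : 0 ≤ v)
    (h : ∀ δ > 0, ∃ c₀ > 0, ∀ c ∈ Set.Ioo 0 c₀, Λ c ≤ (((v + δ) * c ^ 2 / 2 : ℝ) : EReal)) :
    ∃ r : ℝ → ℝ, (∀ η, 0 ≤ r η) ∧ r =o[𝓝[≥] 0] (fun η => √η) ∧
      ∀ η : ℝ, XiPlus Λ (η : EReal) ≤ ((√(2 * v * η) + r η : ℝ) : EReal) := by
  have hbd : ∀ δ > 0, ∃ c₀ > 0, ∀ c ∈ Set.Ioo 0 c₀, ∀ η : ℝ,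
      XiPlus Λ (η : EReal) ≤ (((v + δ) * c / 2 + η / c : ℝ) : EReal) := by
    intro δ hδ
    obtain ⟨c₀, hc₀, hc⟩ := h δ hδ
    refine ⟨c₀, hc₀, fun c hcc η => (XiPlus_le hcc.1 (hc c hcc)).trans_eq ?_⟩
    have := hcc.1.ne'
    congr 1
    field_simp
  have htop : ∀ η : ℝ, XiPlus Λ (η : EReal) ≠ ⊤ := fun η => by
    obtain ⟨c₀, hc₀, hc⟩ := hbd 1 one_pos
    exact ne_top_of_le_ne_top (EReal.coe_ne_top _) (hc (c₀ / 2) ⟨by linarith, by linarith⟩ η)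
  -- The error is the positive part of the excess; nonnegativity later allows the errors of the two
  -- signs to be added.
  refine ⟨fun η => max 0 ((XiPlus Λ (η : EReal)).toReal - √(2 * v * η)),
    fun η => le_max_left _ _, ?_, fun η => ?_⟩
  · rw [isLittleO_iff]
    intro ε hε
    -- With `δ = ε² / 2` one has `2 (v + δ) η = 2 v η + ε² η`, so subadditivity of the root gives an
    -- excess of at most `ε √η`.
    obtain ⟨c₀, hc₀, hc⟩ := hbd (ε ^ 2 / 2) (by positivity)
    set d := v + ε ^ 2 / 2 with hd
    have hdpos : 0 < d := by positivity
    -- `toReal` sends `⊥` to `0`, hence the requirement `0 ≤ y`.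
    have hreal : ∀ η y : ℝ, 0 ≤ y → XiPlus Λ (η : EReal) ≤ (y : EReal) →
        (XiPlus Λ (η : EReal)).toReal ≤ y := by
      intro η y hy hle
      by_cases hb : XiPlus Λ (η : EReal) = ⊥
      · rwa [hb, EReal.toReal_bot]
      · exact EReal.toReal_le_toReal hle hb (EReal.coe_ne_top _)
    have hev : ∀ᶠ η in 𝓝[≥] (0 : ℝ), √(2 * η / d) < c₀ := by
      have : ContinuousAt (fun η : ℝ => √(2 * η / d)) 0 := by fun_prop
      exact (this.eventually_lt continuousAt_const (by simpa using hc₀)).filter_mono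
        nhdsWithin_le_nhds
    filter_upwards [hev, self_mem_nhdsWithin] with η hη hη0
    rw [Set.mem_Ici] at hη0
    rw [Real.norm_eq_abs, Real.norm_eq_abs, abs_of_nonneg (le_max_left _ _),
      abs_of_nonneg (Real.sqrt_nonneg _)]
    refine max_le (by positivity) ?_
    have hle : (XiPlus Λ (η : EReal)).toReal ≤ √(2 * d * η) := by
      rcases hη0.eq_or_lt with rfl | hpos
      -- The filter `𝓝[≥] 0` includes `η = 0`, which forces `r 0 = 0`. The minimiser would be the
      -- excluded `c = 0`, so `c` tends to `0` instead.
      · rw [mul_zero, Real.sqrt_zero]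
        have hc' : ∀ c ∈ Set.Ioo 0 c₀, (XiPlus Λ ((0 : ℝ) : EReal)).toReal ≤ d * c / 2 := by
          intro c hcc
          have := hc c hcc 0
          rw [zero_div, add_zero] at this
          exact hreal 0 _ (by have := hcc.1; positivity) this
        refine ge_of_tendsto (x := 𝓝[>] (0 : ℝ)) (f := fun c => d * c / 2) ?_ ?_
        · have : ContinuousAt (fun c : ℝ => d * c / 2) 0 := by fun_prop
          have h2 := this.tendsto.mono_left (nhdsWithin_le_nhds (s := Set.Ioi 0))
          simpa using h2
        · filter_upwards [Ioo_mem_nhdsGT hc₀] with c hcc using hc' c hcc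
      -- The choice `c = √(2η / d)` minimises `d c / 2 + η / c`, with value `√(2 d η)`.
      · have hcpos : 0 < √(2 * η / d) := by positivity
        refine hreal η _ (Real.sqrt_nonneg _) ((hc _ ⟨hcpos, hη⟩ η).trans_eq ?_)
        congr 1
        have e1 : √(2 * η / d) ^ 2 = 2 * η / d := Real.sq_sqrt (by positivity)
        have e2 : √(2 * d * η) = d * √(2 * η / d) := by
          rw [Real.sqrt_eq_iff_mul_self_eq_of_pos (by positivity)]
          calc d * √(2 * η / d) * (d * √(2 * η / d)) = d ^ 2 * √(2 * η / d) ^ 2 := by ring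
            _ = _ := by rw [e1]; field_simp
        have e3 : η / √(2 * η / d) = d * √(2 * η / d) / 2 := by
          rw [div_eq_iff hcpos.ne']
          calc η = d * (√(2 * η / d) ^ 2) / 2 := by rw [e1]; field_simp
            _ = _ := by ring
        rw [e2, e3]
        ring
    have hsplit : √(2 * d * η) ≤ √(2 * v * η) + ε * √η := by
      have e : 2 * d * η = 2 * v * η + ε ^ 2 * η := by rw [hd]; ring
      rw [e]
      refine Real.sqrt_le_iff.2 ⟨by positivity, ?_⟩
      have h1 : √(2 * v * η) ^ 2 = 2 * v * η := Real.sq_sqrt (by positivity)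
      have h2 : √η ^ 2 = η := Real.sq_sqrt hη0
      have h3 : 0 ≤ 2 * √(2 * v * η) * (ε * √η) := by positivity
      calc 2 * v * η + ε ^ 2 * η = √(2 * v * η) ^ 2 + ε ^ 2 * √η ^ 2 := by rw [h1, h2]
        _ ≤ _ := by linarith
    linarith
  · refine (EReal.le_coe_toReal (htop η)).trans ?_
    rw [EReal.coe_le_coe_iff]
    have := le_max_right 0 ((XiPlus Λ (η : EReal)).toReal - √(2 * v * η))
    linarith

end Xi

/-! ### Reflection of the observable and assembly of the main theorem. -/

theorem centered_neg_left {S : Type*} [MeasurableSpace S] (μ : Measure S) (f : S → ℝ) (c : ℝ) :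
    centered μ (fun x => -f x) c = centered μ f (-c) := by
  ext x
  simp only [centered, integral_neg]
  ring

theorem logMoment_neg_left {S : Type*} [MeasurableSpace S] (μ : Measure S) (β : ℝ) (f : S → ℝ)
    (c : ℝ) : logMoment μ β (fun x => -f x) c = logMoment μ β f (-c) := by
  simp only [logMoment, centered_neg_left]

theorem lambdaLS_ne_bot {S : Type*} [MeasurableSpace S] (μ : Measure S) (β : ℝ) (f : S → ℝ)
    (cm cp : EReal) (c : ℝ) : lambdaLS μ β f cm cp c ≠ ⊥ := by
  rw [lambdaLS]
  split_ifs
  · exact EReal.coe_ne_bot _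
  · exact top_ne_bot

theorem lambdaLS_eq_coe {S : Type*} [MeasurableSpace S] {μ : Measure S} {β : ℝ} {f : S → ℝ}
    {cm cp : EReal} {c l : ℝ} (h : lambdaLS μ β f cm cp c = l) :
    (cm < (c : EReal) ∧ (c : EReal) < cp) ∧ logMoment μ β f c = l := by
  rw [lambdaLS] at h
  split_ifs at h with hc
  · exact ⟨hc, by exact_mod_cast h⟩
  · exact absurd h.symm (EReal.coe_ne_top l)

theorem exists_pos_forall_abs_lt_mem {cm cp : EReal} (hcm : cm < 0) (hcp : 0 < cp) :
    ∃ ε : ℝ, 0 < ε ∧ ∀ c : ℝ, |c| < ε → cm < (c : EReal) ∧ (c : EReal) < cp := by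
  obtain ⟨a, ha, ha0⟩ := EReal.lt_iff_exists_real_btwn.1 hcm
  obtain ⟨b, hb0, hb⟩ := EReal.lt_iff_exists_real_btwn.1 hcp
  have ha0' : a < 0 := by exact_mod_cast ha0
  have hb0' : 0 < b := by exact_mod_cast hb0
  refine ⟨min (-a) b, lt_min (by linarith) hb0', fun c hc => ?_⟩
  have h1 := abs_lt.1 (hc.trans_le (min_le_left _ _))
  have h2 := abs_lt.1 (hc.trans_le (min_le_right _ _))
  exact ⟨ha.trans (by exact_mod_cast (by linarith [h1.1] : a < c)),
    lt_trans (by exact_mod_cast h2.2) hb⟩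

theorem mainTheorem8 {S Ω : Type*} [TopologicalSpace S] [PolishSpace S] [MeasurableSpace S]
    [BorelSpace S] [mΩ : MeasurableSpace Ω]
    (ℱ : Filtration ℝ≥0 mΩ) (X : ℝ≥0 → Ω → S) (p : ℝ≥0 → S → Measure S)
    (P : PathFamily X) (hP : IsMarkovFamily ℱ X p P)
    (μs : Measure S) [IsProbabilityMeasure μs] (hinv : IsInvariantMeasure p μs)
    (β : ℝ) (hβ : 0 < β) (hLS : LogSobolev p μs β)
    (f : S → ℝ) (hf : Integrable f μs)
    (cm cp : EReal) (hcm : cm < 0) (hcp : 0 < cp)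
    (hint : ∀ c : ℝ, cm < (c : EReal) → (c : EReal) < cp →
      Integrable (fun x => Real.exp (β * centered μs f c x)) μs ∧
      Integrable (fun x => Real.exp (β * centered μs f (-c) x)) μs) :
    -- the UQ bound, for every alternative family, initial distribution and time horizon
    (∀ (Q : PathFamily X) (ν : Measure S) [IsProbabilityMeasure ν] (T : ℝ≥0), 0 < T →
      (relEntropy ℱ T (Q.init ν) (P.init μs) ≠ ⊤ →
        (∀ᵐ ω ∂(Q.init ν), IntervalIntegrable (fun t : ℝ => f (X t.toNNReal ω)) volume 0 T) ∧
        Integrable (timeAvg X f T) (Q.init ν)) ∧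
      (((∫ ω, timeAvg X f T ω ∂(Q.init ν)) - ∫ x, f x ∂μs : ℝ) : EReal) ≤
        XiPlus (lambdaLS μs β f cm cp)
          ((relEntropy ℱ T (Q.init ν) (P.init μs) / (T : ℝ≥0∞) : ℝ≥0∞) : EReal) ∧
      ((-((∫ ω, timeAvg X f T ω ∂(Q.init ν)) - ∫ x, f x ∂μs) : ℝ) : EReal) ≤
        XiMinus (lambdaLS μs β f cm cp)
          ((relEntropy ℱ T (Q.init ν) (P.init μs) / (T : ℝ≥0∞) : ℝ≥0∞) : EReal)) ∧
    -- the behaviour of `Λ` at `0`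
    MemLp f 2 μs ∧
    ContDiffAt ℝ 2 (logMoment μs β f) 0 ∧
    logMoment μs β f 0 = 0 ∧
    deriv (logMoment μs β f) 0 = 0 ∧
    deriv (deriv (logMoment μs β f)) 0 = β * Var[f; μs] ∧
    -- the linearized bound, with an error term which does not depend on the alternative process
    ∃ r : ℝ → ℝ, r =o[𝓝[≥] 0] (fun η => √η) ∧
      (∀ η : ℝ, 0 ≤ η →
        XiPlus (lambdaLS μs β f cm cp) (η : EReal) ≤
          ((√(2 * (β * Var[f; μs]) * η) + r η : ℝ) : EReal) ∧
        XiMinus (lambdaLS μs β f cm cp) (η : EReal) ≤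
          ((√(2 * (β * Var[f; μs]) * η) + r η : ℝ) : EReal)) ∧
      (∀ (Q : PathFamily X) (ν : Measure S) [IsProbabilityMeasure ν] (T : ℝ≥0), 0 < T →
        relEntropy ℱ T (Q.init ν) (P.init μs) ≠ ⊤ →
        |(∫ ω, timeAvg X f T ω ∂(Q.init ν)) - ∫ x, f x ∂μs| ≤
          √(2 * (β * Var[f; μs]) *
              ((relEntropy ℱ T (Q.init ν) (P.init μs)).toReal / (T : ℝ))) +
            r ((relEntropy ℱ T (Q.init ν) (P.init μs)).toReal / (T : ℝ))) := by
  obtain ⟨ε, hε, hεD⟩ := exists_pos_forall_abs_lt_mem hcm hcp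
  have hεint : ∀ c, |c| < ε → Integrable (fun x => Real.exp (β * centered μs f c x)) μs :=
    fun c hc => (hint c (hεD c hc).1 (hεD c hc).2).1
  have h0 := zero_mem_interior_integrableExpSet hβ hε hεint
  have h0' := zero_mem_interior_integrableExpSet (f := fun x => -f x) hβ hε fun c hc => by
    rw [centered_neg_left]
    exact hεint (-c) (by rwa [abs_neg])
  have hvar : 0 ≤ β * Var[f; μs] := mul_nonneg hβ.le (variance_nonneg _ _)
  have hvarneg : Var[fun x => -f x; μs] = Var[f; μs] := variance_fun_neg
  have huq : ∀ (Q : PathFamily X) (ν : Measure S) [IsProbabilityMeasure ν] (T : ℝ≥0), 0 < T →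
      (relEntropy ℱ T (Q.init ν) (P.init μs) ≠ ⊤ →
        (∀ᵐ ω ∂(Q.init ν), IntervalIntegrable (fun t : ℝ => f (X t.toNNReal ω)) volume 0 T) ∧
        Integrable (timeAvg X f T) (Q.init ν)) ∧
      (((∫ ω, timeAvg X f T ω ∂(Q.init ν)) - ∫ x, f x ∂μs : ℝ) : EReal) ≤
        XiPlus (lambdaLS μs β f cm cp)
          ((relEntropy ℱ T (Q.init ν) (P.init μs) / (T : ℝ≥0∞) : ℝ≥0∞) : EReal) ∧
      ((-((∫ ω, timeAvg X f T ω ∂(Q.init ν)) - ∫ x, f x ∂μs) : ℝ) : EReal) ≤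
        XiMinus (lambdaLS μs β f cm cp)
          ((relEntropy ℱ T (Q.init ν) (P.init μs) / (T : ℝ≥0∞) : ℝ≥0∞) : EReal) := by
    intro Q ν _ T hT
    have := Q.isProbabilityMeasure_init ν
    have hne : relEntropy ℱ T (Q.init ν) (P.init μs) / (T : ℝ≥0∞) ≠ ⊤ →
        relEntropy ℱ T (Q.init ν) (P.init μs) ≠ ⊤ := fun h h' => h (by
      rw [h', ENNReal.top_div_of_ne_top ENNReal.coe_ne_top])
    have hmain := fun h : relEntropy ℱ T (Q.init ν) (P.init μs) ≠ ⊤ =>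
      hP.uq_bound hinv hβ hLS hf (D := {c : ℝ | cm < (c : EReal) ∧ (c : EReal) < cp})
        ⟨ε / 2, hεD _ (by rw [abs_of_pos (by linarith)]; linarith), by positivity⟩
        (fun c hc => hint c hc.1 hc.2) hT h
    refine ⟨fun h => ⟨(hmain h).1, (hmain h).2.1⟩, ?_, ?_⟩
    · refine le_XiPlus (lambdaLS_ne_bot μs β f cm cp) fun h c _ l hl => ?_
      obtain ⟨hc, rfl⟩ := lambdaLS_eq_coe hl
      rw [ENNReal.toReal_div, ENNReal.coe_toReal]
      exact (hmain (hne h)).2.2 c hc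
    · refine le_XiPlus (Λ := fun c => lambdaLS μs β f cm cp (-c))
        (fun c => lambdaLS_ne_bot μs β f cm cp (-c)) fun h c _ l hl => ?_
      obtain ⟨hc, rfl⟩ := lambdaLS_eq_coe hl
      rw [ENNReal.toReal_div, ENNReal.coe_toReal, mul_neg, ← neg_mul]
      exact (hmain (hne h)).2.2 (-c) hc
  have hlam : ∀ c, |c| < ε → lambdaLS μs β f cm cp c = (logMoment μs β f c : ℝ) := fun c hc => by
    rw [lambdaLS, if_pos (hεD c hc)]
  obtain ⟨r₁, hr₁, ho₁, hXi₁⟩ := exists_isLittleO_XiPlus_le (Λ := lambdaLS μs β f cm cp) hvar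
    fun δ hδ => by
      obtain ⟨c₀, hc₀, hc⟩ := exists_logMoment_le h0 hβ hf hδ
      refine ⟨min c₀ ε, lt_min hc₀ hε, fun c hcc => ?_⟩
      rw [hlam c (by rw [abs_of_pos hcc.1]; exact hcc.2.trans_le (min_le_right _ _))]
      exact_mod_cast hc c ⟨hcc.1, hcc.2.trans_le (min_le_left _ _)⟩
  obtain ⟨r₂, hr₂, ho₂, hXi₂⟩ := exists_isLittleO_XiPlus_le
    (Λ := fun c => lambdaLS μs β f cm cp (-c)) hvar fun δ hδ => by
      -- The reflected `Λ(-c)` of `f` is `Λ(c)` of `-f`, which has the same variance.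
      obtain ⟨c₀, hc₀, hc⟩ := exists_logMoment_le h0' hβ hf.neg hδ
      refine ⟨min c₀ ε, lt_min hc₀ hε, fun c hcc => ?_⟩
      rw [hlam (-c) (by rw [abs_neg, abs_of_pos hcc.1]; exact hcc.2.trans_le (min_le_right _ _)),
        ← logMoment_neg_left, ← hvarneg]
      exact_mod_cast hc c ⟨hcc.1, hcc.2.trans_le (min_le_left _ _)⟩
  have hXi : ∀ η : ℝ, 0 ≤ η →
      XiPlus (lambdaLS μs β f cm cp) (η : EReal) ≤
        ((√(2 * (β * Var[f; μs]) * η) + (r₁ η + r₂ η) : ℝ) : EReal) ∧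
      XiMinus (lambdaLS μs β f cm cp) (η : EReal) ≤
        ((√(2 * (β * Var[f; μs]) * η) + (r₁ η + r₂ η) : ℝ) : EReal) := fun η _ =>
    ⟨(hXi₁ η).trans (EReal.coe_le_coe_iff.2 (by linarith [hr₂ η])),
      (hXi₂ η).trans (EReal.coe_le_coe_iff.2 (by linarith [hr₁ η]))⟩
  refine ⟨huq, memLp_two_of_zero_mem_interior h0, contDiffAt_logMoment h0, logMoment_zero,
    deriv_logMoment_zero h0 hβ hf, deriv_deriv_logMoment_zero h0 hβ hf,
    fun η => r₁ η + r₂ η, ho₁.add ho₂, hXi, fun Q ν _ T hT hne => ?_⟩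
  obtain ⟨-, hp, hm⟩ := huq Q ν T hT
  have hT0 : (T : ℝ≥0∞) ≠ 0 := by exact_mod_cast hT.ne'
  have hη : ((relEntropy ℱ T (Q.init ν) (P.init μs) / (T : ℝ≥0∞) : ℝ≥0∞) : EReal) =
      (((relEntropy ℱ T (Q.init ν) (P.init μs)).toReal / (T : ℝ) : ℝ) : EReal) := by
    rw [← EReal.coe_ennreal_toReal (ENNReal.div_ne_top hne hT0), ENNReal.toReal_div,
      ENNReal.coe_toReal]
  rw [hη] at hp hm
  have hX := hXi ((relEntropy ℱ T (Q.init ν) (P.init μs)).toReal / (T : ℝ)) (by positivity)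
  exact abs_le'.2 ⟨EReal.coe_le_coe_iff.1 (hp.trans hX.1), EReal.coe_le_coe_iff.1 (hm.trans hX.2)⟩
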